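/- Let $(\boldsymbol X_i,Y_i)_{i\ge1}$ be i.i.d. copies of $(\boldsymbol X,Y)$, where $\boldsymbol X\in\mathbb R^q$, $Y\in\{0,1\}$ and, for some parameter $\boldsymbol\beta\in\mathbb R^q$, $P(Y=1\mid \boldsymbol X)=\pi(\boldsymbol X^T\boldsymbol\beta)$ with $\pi(s)=1/(1+e^{-s})$ (logistic regression). Put $\boldsymbol g(\boldsymbol x,y,\boldsymbol\beta)=\boldsymbol x\,(y-\pi(\boldsymbol x^T\boldsymbol\beta))$ and write $\boldsymbol g_i=\boldsymbol g(\boldsymbol X_i,Y_i,\boldsymbol\beta_0)$. Assume the null hypothesis $H_0:\boldsymbol\beta=\boldsymbol\beta_0$ (that is, $\boldsymbol\beta_0$ is the true parameter) and the following conditions. (C1) $\boldsymbol\beta_0$ is the only solution of $E[\boldsymbol g(\boldsymbol X,Y,\boldsymbol\beta)]=\boldsymbol 0$. With probability tending to $1$ as $n\to\infty$ the following hold: (C2) $\boldsymbol 0$ lies in the interior of the convex hull of $\boldsymbol g_1,\dots,\boldsymbol g_n$; (C3) $\sum_{i=1}^n\boldsymbol g_i\boldsymbol g_i^T$ is positive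 definite. (C4) $E[\boldsymbol g\boldsymbol g^T]$ is positive definite at $\boldsymbol\beta_0$. (C5) $\partial\boldsymbol g/\partial\boldsymbol\beta$ is continuous in a neighbourhood of $\boldsymbol\beta_0$. (C6) $\|\partial\boldsymbol g/\partial\boldsymbol\beta\|$ and $\|\boldsymbol g\|^3$ are bounded in a neighbourhood of $\boldsymbol\beta_0$ by an integrable function $G_1(\boldsymbol X,Y)$. (C7) $E[\partial\boldsymbol g/\partial\boldsymbol\beta]$ has rank $q$ at $\boldsymbol\beta_0$. (C8) $\partial^2\boldsymbol g/\partial\boldsymbol\beta\partial\boldsymbol\beta^T$ is continuous in a neighbourhood of $\boldsymbol\beta_0$. (C9) $\|\partial^2\boldsymbol g/\partial\boldsymbol\beta\partial\boldsymbol\beta^T\|$ is bounded in a neighbourhood of $\boldsymbol\beta_0$ by an integrable function $G_2(\boldsymbol X,Y)$. When (C2) and (C3) hold for the sample of size $n$, let $\boldsymbol t$ be the unique vector with $\frac1n\sum_{i=1}^n\frac{\boldsymbol g_i}{1+\boldsymbol t^T\boldsymbol g_i}=\boldsymbol 0$ and $1+\boldsymbol t^T\boldsymbol g_i\ge\frac1n$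 for all $i$, and put $p_i(\boldsymbol\beta_0)=\frac1n\,\frac1{1+\boldsymbol t^T\boldsymbol g_i}$, $\boldsymbol u=(\frac1n,\dots,\frac1n)$ and $d_\phi(\boldsymbol u,\boldsymbol p(\boldsymbol\beta_0))=\sum_{i=1}^n p_i(\boldsymbol\beta_0)\,\phi\big(u_i/p_i(\boldsymbol\beta_0)\big)$. Let $$T_n^{\phi,h}(\boldsymbol\beta_0)=\frac{2n}{\phi''(1)\,h'(0)}\,h\big(d_\phi(\boldsymbol u,\boldsymbol p(\boldsymbol\beta_0))\big),$$ where $h'(0)$ is the one-sided derivative from the right; where (C2) or (C3) fails, $T_n^{\phi,h}(\boldsymbol\beta_0)$ is undefined and is set to $0$. Then, for every twice differentiable convex $\phi:(0,\infty)\to\mathbb R$ with $\phi(1)=0$ and $\phi''(1)>0$, and every differentiable $h:[0,\infty)\to[0,\infty)$ with $h(0)=0$ and $h'(0)>0$, $T_n^{\phi,h}(\boldsymbol\beta_0)$ converges in distribution to $\chi^2_q$ as $n\to\infty$. The same limit holds for the statistics $T_n^{\phi,h}(\boldsymbol\beta_0)$ given by the following pairs: (Rényi) $\phi(x)=\frac{x^a-a(x-1)-1}{a(a-1)}$,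 $h(x)=\frac1{a(a-1)}\log(a(a-1)x+1)$, $a\ne0,1$; (Sharma–Mittal) the same $\phi$ and $h(x)=\frac1{b-1}\big\{[1+a(a-1)x]^{\frac{b-1}{a-1}}-1\big\}$, $a\ne0,1$, $b\neq1$ (here $h'(0)=a$); (Bhattacharyya) $\phi(x)=-x^{1/2}+\frac12(x+1)$, $h(x)=-\log(1-x)$. In these three cases $h$ need only be defined at the attained values of $d_\phi$. -/

import Mathlib

open MeasureTheory ProbabilityTheory Filter Topology Set

noncomputable section

namespace EmpLik

/-- The chi-square distribution with `q` degrees of freedom: the law of the sum of the squares of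
`q` independent standard normal variables. -/
def chiSquared (q : ℕ) : Measure ℝ :=
  (Measure.pi fun _ : Fin q => gaussianReal 0 1).map fun z => ∑ i, z i ^ 2

instance (q : ℕ) : IsProbabilityMeasure (chiSquared q) :=
  Measure.isProbabilityMeasure_map (Measurable.aemeasurable (by fun_prop))

/-! ### The logistic regression model -/

/-- The estimating function `g(x, y, β) = (y - π(xᵀβ)) x`, where `π(s) = 1 / (1 + exp (-s))`. -/
def score {q : ℕ} (x : EuclideanSpace ℝ (Fin q)) (y : ℝ) (β : EuclideanSpace ℝ (Fin q)) :
    EuclideanSpace ℝ (Fin q) :=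
  (y - Real.sigmoid (inner ℝ x β)) • x

/-- The Jacobian matrix `∂g(x, y, β) / ∂β`. -/
def scoreJacobian {q : ℕ} (x : EuclideanSpace ℝ (Fin q)) (y : ℝ)
    (β : EuclideanSpace ℝ (Fin q)) : Matrix (Fin q) (Fin q) ℝ :=
  Matrix.of fun i j => fderiv ℝ (score x y) β (EuclideanSpace.single j 1) i

/-- `(X₀, Y₀), (X₁, Y₁), …` are independent and identically distributed, the responses are
dichotomous, and `P(Y = 1 ∣ X) = π(Xᵀβ)`: the logistic regression model with parameter `β`. -/
structure IsLogisticSample {q : ℕ} {Ω : Type*} [MeasurableSpace Ω] (μ : Measure Ω)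
    (X : ℕ → Ω → EuclideanSpace ℝ (Fin q)) (Y : ℕ → Ω → ℝ)
    (β : EuclideanSpace ℝ (Fin q)) : Prop where
  measurable_X : ∀ i, Measurable (X i)
  measurable_Y : ∀ i, Measurable (Y i)
  indep : iIndepFun (fun i ω => (X i ω, Y i ω)) μ
  identDistrib : ∀ i, IdentDistrib (fun ω => (X i ω, Y i ω)) (fun ω => (X 0 ω, Y 0 ω)) μ μ
  dichotomous : ∀ i, ∀ᵐ ω ∂μ, Y i ω = 0 ∨ Y i ω = 1
  logit : μ⟦Y 0 ⁻¹' {1} | MeasurableSpace.comap (X 0) inferInstance⟧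
    =ᵐ[μ] fun ω => Real.sigmoid (inner ℝ (X 0 ω) β)

/-- The vectors `g(Xᵢ, Yᵢ, β)` of the sample of size `n`. -/
def sampleScore {q : ℕ} {Ω : Type*} (X : ℕ → Ω → EuclideanSpace ℝ (Fin q)) (Y : ℕ → Ω → ℝ)
    (β : EuclideanSpace ℝ (Fin q)) (n : ℕ) (ω : Ω) : Fin n → EuclideanSpace ℝ (Fin q) :=
  fun i => score (X i ω) (Y i ω) β

/-- The two sample conditions on `g₁, …, gₙ`: the null vector lies inside the convex hull of the
`gᵢ`, and the matrix `∑ᵢ gᵢ gᵢᵀ` is positive definite. -/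
def SampleCondition {q n : ℕ} (G : Fin n → EuclideanSpace ℝ (Fin q)) : Prop :=
  0 ∈ interior (convexHull ℝ (range G)) ∧
    (Matrix.of fun j k => ∑ i, G i j * G i k : Matrix (Fin q) (Fin q) ℝ).PosDef

/-- The standing conditions on the model and on the samples, at the true parameter `β₀`. -/
structure RegularityConditions {q : ℕ} {Ω : Type*} [MeasurableSpace Ω] (μ : Measure Ω)
    (X : ℕ → Ω → EuclideanSpace ℝ (Fin q)) (Y : ℕ → Ω → ℝ)
    (β₀ : EuclideanSpace ℝ (Fin q)) : Prop where
  /-- `β₀` is a solution of `E[g(X, Y, β)] = 0` … -/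
  mean_integrable : Integrable (fun ω => score (X 0 ω) (Y 0 ω) β₀) μ
  mean_eq_zero : ∫ ω, score (X 0 ω) (Y 0 ω) β₀ ∂μ = 0
  /-- … and it is the only one. -/
  mean_unique : ∀ β, Integrable (fun ω => score (X 0 ω) (Y 0 ω) β) μ →
    ∫ ω, score (X 0 ω) (Y 0 ω) β ∂μ = 0 → β = β₀
  /-- The conditions on the sample hold with probability tending to one. -/
  sample : Tendsto (fun n => μ {ω | SampleCondition (sampleScore X Y β₀ n ω)}) atTop (𝓝 1)
  /-- `E[g gᵀ]` is positive definite. -/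
  second_moment_posDef : (Matrix.of fun j k => ∫ ω, score (X 0 ω) (Y 0 ω) β₀ j *
    score (X 0 ω) (Y 0 ω) β₀ k ∂μ : Matrix (Fin q) (Fin q) ℝ).PosDef
  /-- `∂g/∂β` is continuous near `β₀`. -/
  continuous_deriv : ∃ U ∈ 𝓝 β₀, ∀ᵐ ω ∂μ,
    ContinuousOn (fun β => fderiv ℝ (score (X 0 ω) (Y 0 ω)) β) U
  /-- `‖∂g/∂β‖` and `‖g‖³` are bounded near `β₀` by an integrable function of `(X, Y)`. -/
  bound_deriv : ∃ U ∈ 𝓝 β₀, ∃ G₁ : EuclideanSpace ℝ (Fin q) × ℝ → ℝ,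
    Integrable (fun ω => G₁ (X 0 ω, Y 0 ω)) μ ∧
    ∀ᵐ ω ∂μ, ∀ β ∈ U, ‖fderiv ℝ (score (X 0 ω) (Y 0 ω)) β‖ ≤ G₁ (X 0 ω, Y 0 ω) ∧
      ‖score (X 0 ω) (Y 0 ω) β‖ ^ 3 ≤ G₁ (X 0 ω, Y 0 ω)
  /-- `E[∂g/∂β]` has rank `q`. -/
  rank_mean_jacobian : (Matrix.of fun i j => ∫ ω, scoreJacobian (X 0 ω) (Y 0 ω) β₀ i j ∂μ :
    Matrix (Fin q) (Fin q) ℝ).rank = q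
  /-- `∂²g/∂β∂βᵀ` is continuous near `β₀`. -/
  continuous_deriv2 : ∃ U ∈ 𝓝 β₀, ∀ᵐ ω ∂μ,
    ContinuousOn (fun β => fderiv ℝ (fun b => fderiv ℝ (score (X 0 ω) (Y 0 ω)) b) β) U
  /-- `‖∂²g/∂β∂βᵀ‖` is bounded near `β₀` by an integrable function of `(X, Y)`. -/
  bound_deriv2 : ∃ U ∈ 𝓝 β₀, ∃ G₂ : EuclideanSpace ℝ (Fin q) × ℝ → ℝ,
    Integrable (fun ω => G₂ (X 0 ω, Y 0 ω)) μ ∧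
    ∀ᵐ ω ∂μ, ∀ β ∈ U, ‖fderiv ℝ (fun b => fderiv ℝ (score (X 0 ω) (Y 0 ω)) b) β‖
      ≤ G₂ (X 0 ω, Y 0 ω)

/-! ### Empirical likelihood weights -/

/-- `t` solves `(1/n) ∑ᵢ gᵢ / (1 + tᵀgᵢ) = 0` subject to `1 + tᵀgᵢ ≥ 1/n` for all `i`. -/
def IsMultiplier {q n : ℕ} (G : Fin n → EuclideanSpace ℝ (Fin q))
    (t : EuclideanSpace ℝ (Fin q)) : Prop :=
  (∀ i, 1 / (n : ℝ) ≤ 1 + inner ℝ t (G i)) ∧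
    (1 / (n : ℝ)) • ∑ i, (1 / (1 + inner ℝ t (G i))) • G i = 0

/-- The vector `t`; under `SampleCondition G` it exists and is unique. -/
def multiplier {q n : ℕ} (G : Fin n → EuclideanSpace ℝ (Fin q)) : EuclideanSpace ℝ (Fin q) :=
  Classical.epsilon (IsMultiplier G)

/-- The weights `pᵢ = (1/n) / (1 + tᵀgᵢ)`. -/
def weights {q n : ℕ} (G : Fin n → EuclideanSpace ℝ (Fin q)) (i : Fin n) : ℝ :=
  1 / (n : ℝ) * (1 / (1 + inner ℝ (multiplier G) (G i)))

/-! ### Divergences and the test statistic -/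

/-- Twice differentiable convex functions `φ : (0, ∞) → ℝ` with `φ(1) = 0` and `φ''(1) > 0`
(only the values on `(0, ∞)` matter). -/
structure IsPhi (φ : ℝ → ℝ) : Prop where
  differentiable : DifferentiableOn ℝ φ (Ioi 0)
  differentiable_deriv : DifferentiableOn ℝ (deriv φ) (Ioi 0)
  convex : ConvexOn ℝ (Ioi 0) φ
  map_one : φ 1 = 0
  deriv2_pos : 0 < deriv (deriv φ) 1

/-- Differentiable functions `h : [0, ∞) → [0, ∞)` with `h(0) = 0` and `h'(0) > 0`
(only the values on `[0, ∞)` matter). -/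
structure IsH (h : ℝ → ℝ) : Prop where
  mapsTo : MapsTo h (Ici 0) (Ici 0)
  differentiable : DifferentiableOn ℝ h (Ici 0)
  map_zero : h 0 = 0
  deriv_pos : 0 < derivWithin h (Ici 0) 0

/-- The `φ`-divergence `∑ᵢ rᵢ φ(pᵢ / rᵢ)` of probability vectors with positive entries
(the empirical likelihood weights and the uniform weights are positive, so the usual conventions
for zero entries play no role). -/
def phiDivergence (φ : ℝ → ℝ) {n : ℕ} (p r : Fin n → ℝ) : ℝ :=
  ∑ i, r i * φ (p i / r i)

open Classical in
/-- The empirical `(h, φ)`-divergence test statistic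
`2 n h(d_φ(u, p(β))) / (φ''(1) h'(0))`, `u = (1/n, …, 1/n)`, on the samples that satisfy the sample
condition at `β`; on the other samples it is undefined, and is given the value `0`. -/
def statistic {q : ℕ} {Ω : Type*} (φ h : ℝ → ℝ) (X : ℕ → Ω → EuclideanSpace ℝ (Fin q))
    (Y : ℕ → Ω → ℝ) (β : EuclideanSpace ℝ (Fin q)) (n : ℕ) (ω : Ω) : ℝ :=
  if SampleCondition (sampleScore X Y β n ω) then
    2 * (n : ℝ) / (deriv (deriv φ) 1 * derivWithin h (Ici 0) 0) *
      h (phiDivergence φ (fun _ : Fin n => 1 / (n : ℝ)) (weights (sampleScore X Y β n ω)))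
  else 0

/-! ### The classical examples -/

/-- `φ(x) = (xᵃ - a (x - 1) - 1) / (a (a - 1))`, used for the Rényi and Sharma–Mittal
divergences. -/
def powerPhi (a x : ℝ) : ℝ := (x ^ a - a * (x - 1) - 1) / (a * (a - 1))

/-- `h(x) = log (a (a - 1) x + 1) / (a (a - 1))`. -/
def renyiH (a x : ℝ) : ℝ := 1 / (a * (a - 1)) * Real.log (a * (a - 1) * x + 1)

/-- `h(x) = ((1 + a (a - 1) x) ^ ((b - 1) / (a - 1)) - 1) / (b - 1)`. -/
def sharmaMittalH (a b x : ℝ) : ℝ :=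
  1 / (b - 1) * ((1 + a * (a - 1) * x) ^ ((b - 1) / (a - 1)) - 1)

/-- `φ(x) = -x^{1/2} + (x + 1) / 2`. -/
def bhattacharyyaPhi (x : ℝ) : ℝ := -√x + 1 / 2 * (x + 1)

/-- `h(x) = -log (1 - x)`. -/
def bhattacharyyaH (x : ℝ) : ℝ := -Real.log (-x + 1)

end EmpLik

end

noncomputable section

namespace EmpLik

/-! ### The sample condition and the multiplier -/

section Deterministic

variable {q n : ℕ} {G : Fin n → EuclideanSpace ℝ (Fin q)}

/-! Write `w_i = tᵀg_i`. Pairing the multiplier equation with `t` gives `∑ w_i / (1 + w_i) = 0`,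
hence `∑ 1 / (1 + w_i) = n`: the weights sum to one, and `u_i / p_i = 1 + w_i`. So `n d_φ = ∑ φ(1 +
w_i) / (1 + w_i)`. The same identity removes the term `φ'(1) w_i` of the Taylor expansion, and when
all `w_i` are small what remains is `(φ''(1) / 2) ∑ w_i²`. Thus `d_φ` is of order `1 / n`, `h` acts
on it through its right derivative at `0`, and the statistic is close to `∑ w_i²` whatever `φ` and
`h` are.

Whitening turns the `g_i` into `Z_i = A g_i` with identity covariance. Put `a_i = Z_i / √n` and `τ =
√n B t`, with `B` the inverse adjoint of `A`, so that `w_i = ⟪τ, a_i⟫`. If `∑ a_i` is bounded, `∑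
a_i a_iᵀ` is near the identity and `max ‖a_i‖` is small, then `τ` is bounded (`norm_multiplier_le`),
expanding `1 / (1 + w_i)` gives `τ ≈ ∑ a_i`, and `∑ w_i² ≈ ‖∑ a_i‖²`
(`abs_sum_sq_inner_sub_norm_sq_le`). All this is deterministic and is collected in
`exists_forall_abs_divergence_sub_norm_sq_le`.

Probability enters in `tendstoInDistribution_of_approx_norm_sq`: the central limit theorem makes `∑
a_i` tight with a standard normal limit, and the strong law for second and third moments supplies
the other two conditions. Slutsky's theorem then gives the law of the squared norm of a standard
normal vector. Convergence in distribution also requires the statistic to be measurable although `t`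
is selected by choice; uniqueness of `t` settles this. -/

lemma pos_of_zero_mem_interior_convexHull (h : 0 ∈ interior (convexHull ℝ (range G)))
    {v : EuclideanSpace ℝ (Fin q)} (hv : v ≠ 0) : ∃ i, 0 < inner ℝ v (G i) := by
  by_contra! hneg
  have hsub : convexHull ℝ (range G) ⊆ {x | inner ℝ v x ≤ 0} :=
    convexHull_min (by rintro _ ⟨i, rfl⟩; exact hneg i)
      (convex_halfSpace_le (innerSL ℝ v).toLinearMap.isLinear 0)
  obtain ⟨ε, hε, hball⟩ := Metric.mem_nhds_iff.1 (mem_interior_iff_mem_nhds.1 h)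
  have hv' : 0 < ‖v‖ := norm_pos_iff.2 hv
  have hmem : (ε / (2 * ‖v‖)) • v ∈ Metric.ball (0 : EuclideanSpace ℝ (Fin q)) ε := by
    rw [mem_ball_zero_iff, norm_smul, Real.norm_of_nonneg (by positivity)]
    field_simp
    linarith
  have h1 := hsub (hball hmem)
  simp only [mem_ofPred_eq, inner_smul_right, real_inner_self_eq_norm_sq] at h1
  have : 0 < ε / (2 * ‖v‖) * ‖v‖ ^ 2 := by positivity
  linarith

/-- Compactness makes the positivity uniform: `max_i ⟪v, G i⟫` is continuous and positive on the
unit sphere, and it is homogeneous in `v`. -/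
lemma exists_forall_sphere_le_inner (hn : 0 < n) (h : ∀ v ≠ 0, ∃ i, 0 < inner ℝ v (G i)) :
    ∃ ε > 0, ∀ v, ∃ i, ε * ‖v‖ ≤ inner ℝ v (G i) := by
  have : Nonempty (Fin n) := ⟨⟨0, hn⟩⟩
  let m : EuclideanSpace ℝ (Fin q) → ℝ := fun v =>
    Finset.univ.sup' Finset.univ_nonempty fun i => inner ℝ v (G i)
  have hm : Continuous m := by
    refine Continuous.finset_sup'_apply _ fun i _ => by fun_prop
  have key : ∃ ε > 0, ∀ v ∈ Metric.sphere (0 : EuclideanSpace ℝ (Fin q)) 1, ε ≤ m v := by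
    -- The sphere is empty when `q = 0`.
    rcases (Metric.sphere (0 : EuclideanSpace ℝ (Fin q)) 1).eq_empty_or_nonempty with he | hne
    · exact ⟨1, one_pos, by simp [he]⟩
    obtain ⟨v, hv, hmin⟩ := (isCompact_sphere _ _).exists_isMinOn hne hm.continuousOn
    have hv0 : v ≠ 0 := by
      rintro rfl
      simp at hv
    obtain ⟨i, hi⟩ := h v hv0
    exact ⟨m v, hi.trans_le (Finset.le_sup' (fun i => inner ℝ v (G i)) (Finset.mem_univ i)),
      fun w hw => hmin hw⟩
  obtain ⟨ε, hε, hle⟩ := key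
  refine ⟨ε, hε, fun v => ?_⟩
  rcases eq_or_ne v 0 with rfl | hv
  · exact ⟨⟨0, hn⟩, by simp⟩
  have hv' : 0 < ‖v‖ := norm_pos_iff.2 hv
  have h1 := hle (‖v‖⁻¹ • v) (by simp [norm_smul, hv'.ne'])
  obtain ⟨i, -, hi⟩ := Finset.exists_mem_eq_sup' Finset.univ_nonempty
    fun i => inner ℝ (‖v‖⁻¹ • v) (G i)
  refine ⟨i, ?_⟩
  have h2 : ε ≤ inner ℝ (‖v‖⁻¹ • v) (G i) := h1.trans_eq hi
  rw [real_inner_smul_left, ← div_eq_inv_mul, le_div_iff₀ hv'] at h2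
  exact h2

/-- A point of the `ε`-ball outside the hull would be strictly separated from it by some `v`,
against `ε * ‖v‖ ≤ ⟪v, G i⟫` for some `i`. -/
lemma zero_mem_interior_convexHull (hn : 0 < n) (h : ∀ v ≠ 0, ∃ i, 0 < inner ℝ v (G i)) :
    0 ∈ interior (convexHull ℝ (range G)) := by
  obtain ⟨ε, hε, hle⟩ := exists_forall_sphere_le_inner hn h
  refine mem_interior_iff_mem_nhds.2 (Metric.mem_nhds_iff.2 ⟨ε, hε, fun x hx => ?_⟩)
  by_contra hxC
  have hclosed : IsClosed (convexHull ℝ (range G)) :=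
    ((finite_range G).isCompact_convexHull (𝕜 := ℝ)).isClosed
  obtain ⟨f, u, hfC, hfx⟩ := geometric_hahn_banach_closed_point (convex_convexHull ℝ _) hclosed hxC
  set v := (InnerProductSpace.toDual ℝ (EuclideanSpace ℝ (Fin q))).symm f with hv
  have hf : ∀ y, f y = inner ℝ v y := fun y => by simp [hv]
  obtain ⟨i, hi⟩ := hle v
  have h1 := hfC (G i) (subset_convexHull ℝ _ (mem_range_self i))
  have h2 : inner ℝ v x ≤ ‖v‖ * ‖x‖ := real_inner_le_norm v x
  rw [mem_ball_zero_iff] at hx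
  rw [hf] at h1 hfx
  nlinarith [norm_nonneg v]

/-- Positive definiteness of `∑ G i (G i)ᵀ` comes for free, since its quadratic form is `∑ ⟪x, G
i⟫²`. The clause `0 < n` matters only for `q = 0`, where the other one is vacuous. -/
lemma sampleCondition_iff :
    SampleCondition G ↔ 0 < n ∧ ∀ v ≠ 0, ∃ i, 0 < inner ℝ v (G i) := by
  refine ⟨fun h => ⟨?_, fun v => pos_of_zero_mem_interior_convexHull h.1⟩,
    fun ⟨hn, h⟩ => ⟨zero_mem_interior_convexHull hn h, ?_⟩⟩
  · rcases Nat.eq_zero_or_pos n with rfl | hn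
    · have := h.1
      simp [range_eq_empty] at this
    · exact hn
  · refine Matrix.posDef_iff_dotProduct_mulVec.2 ⟨?_, fun x hx => ?_⟩
    · ext j k
      simp [mul_comm]
    · have hq : star x ⬝ᵥ ((Matrix.of fun j k => ∑ i, G i j * G i k) : Matrix (Fin q) (Fin q) ℝ).mulVec x
          = ∑ i, (inner ℝ (WithLp.toLp 2 x) (G i)) ^ 2 := by
        simp only [dotProduct, Matrix.mulVec, Matrix.of_apply, Pi.star_apply, star_trivial,
          PiLp.inner_apply, RCLike.inner_apply, conj_trivial, sq, Finset.sum_mul, Finset.mul_sum]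
        rw [Finset.sum_comm]
        conv_rhs => rw [Finset.sum_comm]
        rw [Finset.sum_comm]
        refine Finset.sum_congr rfl fun i _ => ?_
        rw [Finset.sum_comm]
        refine Finset.sum_congr rfl fun j _ => Finset.sum_congr rfl fun k _ => ?_
        ring
      obtain ⟨i, hi⟩ := h (WithLp.toLp 2 x) (by simpa using hx)
      rw [hq]
      exact Finset.sum_pos' (fun i _ => sq_nonneg _) ⟨i, Finset.mem_univ i, by positivity⟩

lemma IsMultiplier.one_add_pos (hn : 0 < n) {t : EuclideanSpace ℝ (Fin q)}
    (ht : IsMultiplier G t) (i : Fin n) : 0 < 1 + inner ℝ t (G i) :=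
  (by positivity : (0 : ℝ) < 1 / n).trans_le (ht.1 i)

lemma IsMultiplier.sum_eq_zero (hn : 0 < n) {t : EuclideanSpace ℝ (Fin q)}
    (ht : IsMultiplier G t) : ∑ i, (1 / (1 + inner ℝ t (G i))) • G i = 0 := by
  have : (1 / (n : ℝ)) ≠ 0 := by positivity
  exact (smul_eq_zero.1 ht.2).resolve_left this

lemma sum_inv_one_add_eq {t : EuclideanSpace ℝ (Fin q)} (hpos : ∀ i, 0 < 1 + inner ℝ t (G i))
    (hsum : ∑ i, (1 / (1 + inner ℝ t (G i))) • G i = 0) :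
    ∑ i, 1 / (1 + inner ℝ t (G i)) = n := by
  have h := congrArg (fun z => inner ℝ t z) hsum
  simp only [inner_sum, inner_smul_right, inner_zero_right] at h
  have h2 : ∑ i, (1 / (1 + inner ℝ t (G i)) + 1 / (1 + inner ℝ t (G i)) * inner ℝ t (G i)) = n := by
    rw [Finset.sum_congr rfl fun i _ => show _ = (1 : ℝ) by have := (hpos i).ne'; field_simp]
    simp
  rw [Finset.sum_add_distrib, h, add_zero] at h2
  exact h2

/-- The multiplier equation is the critical point equation of `∏ (1 + ⟪t, G i⟫)`, which is maximized
over the compact polytope where all factors are nonnegative. The product, unlike its logarithm, is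
continuous up to the boundary. -/
lemma SampleCondition.exists_isMultiplier (hG : SampleCondition G) : ∃ t, IsMultiplier G t := by
  obtain ⟨hn, hG⟩ := sampleCondition_iff.1 hG
  have hn' : Nonempty (Fin n) := ⟨⟨0, hn⟩⟩
  obtain ⟨ε, hε, hle⟩ := exists_forall_sphere_le_inner hn hG
  let D : Set (EuclideanSpace ℝ (Fin q)) := {t | ∀ i, 0 ≤ 1 + inner ℝ t (G i)}
  have hDclosed : IsClosed D := by
    simp only [D, ofPred_forall]
    exact isClosed_iInter fun i => isClosed_le (by fun_prop) (by fun_prop)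
  have hDbdd : D ⊆ Metric.closedBall 0 (1 / ε) := by
    intro t ht
    obtain ⟨i, hi⟩ := hle (-t)
    have := ht i
    rw [inner_neg_left, norm_neg] at hi
    rw [mem_closedBall_zero_iff, le_div_iff₀ hε]
    linarith
  have hDcomp : IsCompact D := (isCompact_closedBall _ _).of_isClosed_subset hDclosed hDbdd
  let P : EuclideanSpace ℝ (Fin q) → ℝ := fun t => ∏ i, (1 + inner ℝ t (G i))
  have hP : Continuous P := by fun_prop
  obtain ⟨t, htD, hmax⟩ := hDcomp.exists_isMaxOn ⟨0, by simp [D]⟩ hP.continuousOn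
  -- Comparison with `t = 0` shows that no factor vanishes at the maximum, so the maximum is
  -- interior.
  have hP1 : 1 ≤ P t := by simpa [P] using hmax (show (0 : EuclideanSpace ℝ (Fin q)) ∈ D by simp [D])
  have hpos : ∀ i, 0 < 1 + inner ℝ t (G i) := by
    intro i
    refine lt_of_le_of_ne (htD i) fun h0 => ?_
    have : P t = 0 := Finset.prod_eq_zero (Finset.mem_univ i) h0.symm
    linarith
  have hsum : ∑ i, (1 / (1 + inner ℝ t (G i))) • G i = 0 := by
    have hnhds : D ∈ 𝓝 t := by
      have : {s | ∀ i, 0 < 1 + inner ℝ s (G i)} ∈ 𝓝 t := by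
        refine IsOpen.mem_nhds ?_ hpos
        simp only [ofPred_forall]
        exact isOpen_iInter_of_finite fun i => isOpen_lt (by fun_prop) (by fun_prop)
      exact mem_of_superset this fun s hs i => (hs i).le
    have hloc : IsLocalMax P t := hmax.isLocalMax hnhds
    refine ext_inner_left ℝ fun v => ?_
    have hloc2 : IsLocalMax (fun s : ℝ => P (t + s • v)) 0 := by
      have hc : Tendsto (fun s : ℝ => t + s • v) (𝓝 0) (𝓝 t) := by
        have : Continuous fun s : ℝ => t + s • v := by fun_prop
        simpa using this.tendsto 0
      have := hc.eventually hloc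
      filter_upwards [this] with s hs
      simpa using hs
    have hder : HasDerivAt (fun s : ℝ => P (t + s • v))
        (∑ i, (∏ j ∈ Finset.univ.erase i, (1 + inner ℝ t (G j))) • inner ℝ v (G i)) 0 := by
      have h1 : ∀ i ∈ Finset.univ, HasDerivAt (fun s : ℝ => 1 + inner ℝ (t + s • v) (G i))
          (inner ℝ v (G i)) 0 := by
        intro i _
        have h2 : (fun s : ℝ => 1 + inner ℝ (t + s • v) (G i))
            = fun s => s * inner ℝ v (G i) + (1 + inner ℝ t (G i)) := by
          ext s
          rw [inner_add_left, real_inner_smul_left]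
          ring
        rw [h2]
        simpa using ((hasDerivAt_id (0 : ℝ)).mul_const (inner ℝ v (G i))).add_const
          (1 + inner ℝ t (G i))
      have h3 := HasDerivAt.fun_finsetProd h1
      simpa [P] using h3
    have h0 := hloc2.hasDerivAt_eq_zero hder
    have h4 : ∀ i, (∏ j ∈ Finset.univ.erase i, (1 + inner ℝ t (G j))) • inner ℝ v (G i)
        = P t * (1 / (1 + inner ℝ t (G i)) * inner ℝ v (G i)) := by
      intro i
      simp only [P]
      rw [← Finset.mul_prod_erase Finset.univ (fun j => 1 + inner ℝ t (G j)) (Finset.mem_univ i)]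
      have := (hpos i).ne'
      rw [smul_eq_mul]
      field_simp
    rw [Finset.sum_congr rfl fun i _ => h4 i, ← Finset.mul_sum] at h0
    have h5 := (mul_eq_zero.1 h0).resolve_left (by linarith)
    simpa [inner_sum, inner_smul_right] using h5
  refine ⟨t, fun i => ?_, by rw [hsum, smul_zero]⟩
  -- The lower bound `1 / n` is automatic: the positive numbers `1 / (1 + ⟪t, G i⟫)` sum to `n`, so
  -- none exceeds `n`.
  have h6 := sum_inv_one_add_eq hpos hsum
  have h7 : 1 / (1 + inner ℝ t (G i)) ≤ n := by
    rw [← h6]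
    exact Finset.single_le_sum (f := fun i => 1 / (1 + inner ℝ t (G i)))
      (fun j _ => (one_div_pos.2 (hpos j)).le) (Finset.mem_univ i)
  rw [div_le_iff₀ (hpos i)] at h7
  rw [div_le_iff₀ (by positivity)]
  linarith

lemma SampleCondition.isMultiplier (hG : SampleCondition G) : IsMultiplier G (multiplier G) :=
  Classical.epsilon_spec hG.exists_isMultiplier

/-- Pairing the difference of the two equations with `s - t` leaves a sum of nonnegative terms equal
to zero, one of which is positive unless `s = t`. -/
lemma IsMultiplier.unique (hG : SampleCondition G) {s t : EuclideanSpace ℝ (Fin q)}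
    (hs : IsMultiplier G s) (ht : IsMultiplier G t) : s = t := by
  obtain ⟨hn, hG⟩ := sampleCondition_iff.1 hG
  have h1 : ∑ i, (inner ℝ (s - t) (G i)) ^ 2
      / ((1 + inner ℝ s (G i)) * (1 + inner ℝ t (G i))) = 0 := by
    have h2 := congrArg (fun z => inner ℝ (s - t) z) (hs.sum_eq_zero hn)
    have h3 := congrArg (fun z => inner ℝ (s - t) z) (ht.sum_eq_zero hn)
    simp only [inner_sum, inner_smul_right, inner_zero_right] at h2 h3
    rw [← sub_eq_zero.2 (h3.trans h2.symm), ← Finset.sum_sub_distrib]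
    refine Finset.sum_congr rfl fun i _ => ?_
    have e1 := (hs.one_add_pos hn i).ne'
    have e2 := (ht.one_add_pos hn i).ne'
    have e3 : inner ℝ (s - t) (G i) = (1 + inner ℝ s (G i)) - (1 + inner ℝ t (G i)) := by
      rw [inner_sub_left]
      ring
    rw [e3]
    field_simp
  by_contra hst
  obtain ⟨i, hi⟩ := hG (s - t) (sub_ne_zero.2 hst)
  rw [Finset.sum_eq_zero_iff_of_nonneg] at h1
  · have h2 := h1 i (Finset.mem_univ i)
    have e1 := hs.one_add_pos hn i
    have e2 := ht.one_add_pos hn i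
    have : 0 < (inner ℝ (s - t) (G i)) ^ 2
      / ((1 + inner ℝ s (G i)) * (1 + inner ℝ t (G i))) := by positivity
    linarith
  · intro i _
    have e1 := hs.one_add_pos hn i
    have e2 := ht.one_add_pos hn i
    positivity

lemma SampleCondition.weights_pos (hG : SampleCondition G) (i : Fin n) : 0 < weights G i := by
  have hn := (sampleCondition_iff.1 hG).1
  have := hG.isMultiplier.one_add_pos hn i
  rw [weights]
  positivity

lemma SampleCondition.sum_weights (hG : SampleCondition G) : ∑ i, weights G i = 1 := by
  have hn := (sampleCondition_iff.1 hG).1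
  have h := hG.isMultiplier
  simp only [weights]
  rw [← Finset.mul_sum, sum_inv_one_add_eq (h.one_add_pos hn) (h.sum_eq_zero hn)]
  field_simp

/-- Jensen's inequality. Nonnegativity is needed because `h` is controlled only to the right of `0`.
-/
lemma phiDivergence_nonneg {φ : ℝ → ℝ} (hφ : ConvexOn ℝ (Ioi 0) φ) (h1 : φ 1 = 0)
    {p r : Fin n → ℝ} (hp : ∀ i, 0 < p i) (hr : ∀ i, 0 < r i) (hps : ∑ i, p i = 1)
    (hrs : ∑ i, r i = 1) : 0 ≤ phiDivergence φ p r := by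
  have h := hφ.map_sum_le (t := Finset.univ) (w := r) (p := fun i => p i / r i)
    (fun i _ => (hr i).le) hrs (fun i _ => div_pos (hp i) (hr i))
  have h2 : ∑ i, r i • (p i / r i) = 1 := by
    rw [← hps]
    refine Finset.sum_congr rfl fun i _ => ?_
    rw [smul_eq_mul, mul_div_cancel₀ _ (hr i).ne']
  rw [h2, h1] at h
  simpa [phiDivergence] using h

lemma SampleCondition.phiDivergence_nonneg {φ : ℝ → ℝ} (hφ : IsPhi φ) (hG : SampleCondition G) :
    0 ≤ phiDivergence φ (fun _ : Fin n => 1 / (n : ℝ)) (weights G) := by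
  have hn := (sampleCondition_iff.1 hG).1
  refine EmpLik.phiDivergence_nonneg hφ.convex hφ.map_one (fun i => by positivity) hG.weights_pos ?_
    hG.sum_weights
  simp only [Finset.sum_const, Finset.card_univ, Fintype.card_fin, nsmul_eq_mul]
  field_simp

end Deterministic

/-! ### Measurability of the statistic -/

section Measurability

variable {q n : ℕ}

/-- The complement is the projection, along the compact unit sphere, of a closed set. -/
lemma isOpen_sampleCondition :
    IsOpen {G : Fin n → EuclideanSpace ℝ (Fin q) | SampleCondition G} := by
  rcases Nat.eq_zero_or_pos n with rfl | hn
  · simp [sampleCondition_iff]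
  have hK : IsClosed {p : Metric.sphere (0 : EuclideanSpace ℝ (Fin q)) 1 ×
      (Fin n → EuclideanSpace ℝ (Fin q)) | ∀ i, inner ℝ (p.1 : EuclideanSpace ℝ (Fin q)) (p.2 i) ≤ 0} := by
    simp only [ofPred_forall]
    exact isClosed_iInter fun i => isClosed_le (by fun_prop) (by fun_prop)
  have hproj := isClosedMap_snd_of_compactSpace _ hK
  convert hproj.isOpen_compl using 1
  ext G
  simp only [sampleCondition_iff, mem_ofPred_eq, mem_compl_iff, mem_image, Prod.exists,
    exists_eq_right, not_exists, not_forall, not_le]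
  refine ⟨fun h v => h.2 v (fun h0 => ?_), fun h => ⟨hn, fun v hv => ?_⟩⟩
  · have := v.2
    rw [h0] at this
    simp at this
  · have hv' : 0 < ‖v‖ := norm_pos_iff.2 hv
    obtain ⟨i, hi⟩ := h ⟨‖v‖⁻¹ • v, by simp [norm_smul, hv'.ne']⟩
    refine ⟨i, ?_⟩
    rw [real_inner_smul_left] at hi
    exact pos_of_mul_pos_right hi (by positivity)

lemma isClosed_setOf_isMultiplier (hn : 0 < n) :
    IsClosed {p : EuclideanSpace ℝ (Fin q) × (Fin n → EuclideanSpace ℝ (Fin q)) |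
      IsMultiplier p.2 p.1} := by
  have hC : IsClosed {p : EuclideanSpace ℝ (Fin q) × (Fin n → EuclideanSpace ℝ (Fin q)) |
      ∀ i, 1 / (n : ℝ) ≤ 1 + inner ℝ p.1 (p.2 i)} := by
    simp only [ofPred_forall]
    exact isClosed_iInter fun i => isClosed_le (by fun_prop) (by fun_prop)
  have hcont : ContinuousOn (fun p : EuclideanSpace ℝ (Fin q) × (Fin n → EuclideanSpace ℝ (Fin q)) =>
      (1 / (n : ℝ)) • ∑ i, (1 / (1 + inner ℝ p.1 (p.2 i))) • p.2 i)
      {p | ∀ i, 1 / (n : ℝ) ≤ 1 + inner ℝ p.1 (p.2 i)} := by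
    suffices h0 : ∀ i ∈ (Finset.univ : Finset (Fin n)), ContinuousOn
        (fun p : EuclideanSpace ℝ (Fin q) × (Fin n → EuclideanSpace ℝ (Fin q)) =>
          (1 / (1 + inner ℝ p.1 (p.2 i))) • p.2 i)
        {p | ∀ i, 1 / (n : ℝ) ≤ 1 + inner ℝ p.1 (p.2 i)} from
      (continuousOn_finsetSum _ h0).const_smul (1 / (n : ℝ))
    intro i _
    have h1 : Continuous fun p : EuclideanSpace ℝ (Fin q) × (Fin n → EuclideanSpace ℝ (Fin q)) =>
        1 + inner ℝ p.1 (p.2 i) := by fun_prop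
    have h2 : Continuous fun p : EuclideanSpace ℝ (Fin q) × (Fin n → EuclideanSpace ℝ (Fin q)) =>
        p.2 i := by fun_prop
    refine ContinuousOn.smul (ContinuousOn.div continuousOn_const h1.continuousOn fun p hp => ?_)
      h2.continuousOn
    have : 0 < 1 / (n : ℝ) := by positivity
    exact (this.trans_le (hp i)).ne'
  have := hcont.preimage_isClosed_of_isClosed hC (isClosed_singleton (x := 0))
  convert this using 1
  rfl

open Classical in
-- By uniqueness, the multiplier lies in a closed set `F` exactly when some multiplier does. Cutting
-- `F` by balls writes this as a countable union of projections of closed sets along compact ones.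
lemma measurable_multiplier :
    Measurable fun G : Fin n → EuclideanSpace ℝ (Fin q) =>
      if SampleCondition G then multiplier G else 0 := by
  rcases Nat.eq_zero_or_pos n with rfl | hn
  · exact measurable_of_finite _
  refine measurable_of_isClosed fun F hF => ?_
  have hU := (isOpen_sampleCondition (q := q) (n := n)).measurableSet
  have hproj : ∀ k : ℕ, IsClosed {G : Fin n → EuclideanSpace ℝ (Fin q) |
      ∃ t ∈ F ∩ Metric.closedBall 0 k, IsMultiplier G t} := by
    intro k
    have hc : IsCompact (F ∩ Metric.closedBall (0 : EuclideanSpace ℝ (Fin q)) k) :=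
      (isCompact_closedBall _ _).inter_left hF
    have := isCompact_iff_compactSpace.1 hc
    have hcl : IsClosed {p : (F ∩ Metric.closedBall (0 : EuclideanSpace ℝ (Fin q)) k : Set _) ×
        (Fin n → EuclideanSpace ℝ (Fin q)) | IsMultiplier p.2 (p.1 : EuclideanSpace ℝ (Fin q))} :=
      (isClosed_setOf_isMultiplier hn).preimage
        ((continuous_subtype_val.comp continuous_fst).prodMk continuous_snd)
    convert isClosedMap_snd_of_compactSpace _ hcl using 1
    ext G
    simp
  have hset : (fun G : Fin n → EuclideanSpace ℝ (Fin q) =>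
        if SampleCondition G then multiplier G else 0) ⁻¹' F =
      ({G | SampleCondition G} ∩ ⋃ k : ℕ, {G | ∃ t ∈ F ∩ Metric.closedBall 0 k, IsMultiplier G t}) ∪
        ({G | SampleCondition G}ᶜ ∩ {_G | (0 : EuclideanSpace ℝ (Fin q)) ∈ F}) := by
    ext G
    by_cases hG : SampleCondition G
    · simp only [mem_preimage, hG, if_true, mem_union, mem_inter_iff, mem_ofPred_eq, true_and,
        mem_iUnion, mem_compl_iff, not_true, false_and, or_false, mem_closedBall_zero_iff]
      constructor
      · intro h
        obtain ⟨k, hk⟩ := exists_nat_ge ‖multiplier G‖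
        exact ⟨k, _, ⟨h, hk⟩, hG.isMultiplier⟩
      · rintro ⟨k, t, ⟨ht, -⟩, htG⟩
        rwa [hG.isMultiplier.unique hG htG]
    · simp [hG]
  rw [hset]
  exact (hU.inter (MeasurableSet.iUnion fun k => (hproj k).measurableSet)).union
    (hU.compl.inter (MeasurableSet.const _))

open Classical in
lemma measurable_statistic_of_sample {φ h : ℝ → ℝ} (hφ : IsPhi φ)
    (hh : Measurable fun x => h (max x 0)) (c : ℝ) :
    Measurable fun G : Fin n → EuclideanSpace ℝ (Fin q) =>
      if SampleCondition G then
        c * h (phiDivergence φ (fun _ : Fin n => 1 / (n : ℝ)) (weights G)) else 0 := by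
  have hU := (isOpen_sampleCondition (q := q) (n := n)).measurableSet
  let t : (Fin n → EuclideanSpace ℝ (Fin q)) → EuclideanSpace ℝ (Fin q) := fun G =>
    if SampleCondition G then multiplier G else 0
  have ht : Measurable t := measurable_multiplier
  -- Only values of `φ` on `(0, ∞)` are evaluated on good samples, so `φ` may be cut off to a
  -- function measurable on the whole line.
  let φ' : ℝ → ℝ := (Ioi (0 : ℝ)).piecewise φ fun _ => 0
  have hφ' : Measurable φ' :=
    hφ.differentiable.continuousOn.measurable_piecewise continuousOn_const measurableSet_Ioi
  let w : (Fin n → EuclideanSpace ℝ (Fin q)) → Fin n → ℝ := fun G i =>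
    1 / (n : ℝ) * (1 / (1 + inner ℝ (t G) (G i)))
  have hw : ∀ i, Measurable fun G => w G i := by
    intro i
    have : Measurable fun G : Fin n → EuclideanSpace ℝ (Fin q) => inner ℝ (t G) (G i) :=
      ht.inner (measurable_pi_apply i)
    fun_prop
  have hd : Measurable fun G => ∑ i, w G i * φ' (1 / (n : ℝ) / w G i) := by fun_prop
  have hm : Measurable fun G => if SampleCondition G then
      c * h (max (∑ i, w G i * φ' (1 / (n : ℝ) / w G i)) 0) else 0 :=
    Measurable.ite hU ((hh.comp hd).const_mul c) measurable_const
  convert hm using 2 with G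
  by_cases hG : SampleCondition G
  · have hn := (sampleCondition_iff.1 hG).1
    have hwe : ∀ i, w G i = weights G i := fun i => by simp [w, t, hG, weights]
    have hde : ∑ i, w G i * φ' (1 / (n : ℝ) / w G i)
        = phiDivergence φ (fun _ : Fin n => 1 / (n : ℝ)) (weights G) := by
      refine Finset.sum_congr rfl fun i _ => ?_
      have hpos : 1 / (n : ℝ) / weights G i ∈ Ioi (0 : ℝ) := by
        have := hG.weights_pos i
        exact div_pos (by positivity) this
      rw [hwe, show φ' (1 / (n : ℝ) / weights G i) = _ from piecewise_eq_of_mem _ _ _ hpos]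
    simp only [hG, if_true]
    rw [hde, max_eq_left (hG.phiDivergence_nonneg hφ)]
  · simp [hG]

end Measurability

/-! ### Local expansions -/

section Expansion

/-- The second derivative need not be continuous. Differentiability of `φ'` at `1` bounds the
derivative of the Taylor remainder by `ε * |w|` on the ball of radius `|w|`, and the mean value
inequality integrates this bound. -/
lemma IsPhi.exists_taylor_bound {φ : ℝ → ℝ} (hφ : IsPhi φ) {ε : ℝ} (hε : 0 < ε) :
    ∃ η > 0, ∀ w, |w| ≤ η →
      |φ (1 + w) - deriv φ 1 * w - deriv (deriv φ) 1 / 2 * w ^ 2| ≤ ε * w ^ 2 := by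
  set c := deriv (deriv φ) 1
  have h2 : HasDerivAt (deriv φ) c 1 :=
    ((hφ.differentiable_deriv 1 (by simp)).differentiableAt (Ioi_mem_nhds one_pos)).hasDerivAt
  have h3 := (hasDerivAt_iff_isLittleO.1 h2).def hε
  obtain ⟨η, hη, hball⟩ := Metric.eventually_nhds_iff.1 h3
  refine ⟨min (η / 2) (1 / 2), by positivity, fun w hw => ?_⟩
  have hw1 : |w| ≤ η / 2 := hw.trans (min_le_left _ _)
  have hw2 : |w| ≤ 1 / 2 := hw.trans (min_le_right _ _)
  let ρ : ℝ → ℝ := fun x => φ x - deriv φ 1 * (x - 1) - c / 2 * (x - 1) ^ 2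
  have hρ : ∀ x ∈ Metric.closedBall (1 : ℝ) |w|,
      HasDerivWithinAt ρ (deriv φ x - deriv φ 1 - c * (x - 1)) (Metric.closedBall (1 : ℝ) |w|) x := by
    intro x hx
    rw [Metric.mem_closedBall, Real.dist_eq] at hx
    have hx0 : 0 < x := by
      have := (abs_le.1 (hx.trans hw2)).1
      linarith
    have h4 : HasDerivAt φ (deriv φ x) x :=
      ((hφ.differentiable x hx0).differentiableAt (Ioi_mem_nhds hx0)).hasDerivAt
    have h5 : HasDerivAt (fun y : ℝ => y - 1) 1 x := (hasDerivAt_id x).sub_const 1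
    have h6 := (h4.sub (h5.const_mul (deriv φ 1))).sub ((h5.pow 2).const_mul (c / 2))
    refine (h6.congr_deriv ?_).hasDerivWithinAt
    push_cast
    ring
  have hbound : ∀ x ∈ Metric.closedBall (1 : ℝ) |w|,
      ‖deriv φ x - deriv φ 1 - c * (x - 1)‖ ≤ ε * |w| := by
    intro x hx
    rw [Metric.mem_closedBall] at hx
    have h7 := hball (lt_of_le_of_lt (hx.trans hw1) (by linarith))
    rw [smul_eq_mul, mul_comm (x - 1)] at h7
    rw [Real.dist_eq] at hx
    exact h7.trans (by rw [Real.norm_eq_abs]; gcongr)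
  have h8 := (convex_closedBall (1 : ℝ) |w|).norm_image_sub_le_of_norm_hasDerivWithin_le hρ hbound
    (Metric.mem_closedBall_self (abs_nonneg w))
    (show 1 + w ∈ Metric.closedBall (1 : ℝ) |w| by simp)
  have h9 : ε * |w| * ‖1 + w - 1‖ = ε * w ^ 2 := by
    rw [add_sub_cancel_left, Real.norm_eq_abs, mul_assoc, abs_mul_abs_self, sq]
  rw [h9] at h8
  simpa [ρ, hφ.map_one] using h8

lemma IsPhi.exists_quadratic_bound {φ : ℝ → ℝ} (hφ : IsPhi φ) {ε : ℝ} (hε : 0 < ε) :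
    ∃ η > 0, η ≤ 1 / 2 ∧ ∀ w, |w| ≤ η →
      |(φ (1 + w) - deriv φ 1 * w) / (1 + w) - deriv (deriv φ) 1 / 2 * w ^ 2| ≤ ε * w ^ 2 := by
  set c := deriv (deriv φ) 1
  have hc : 0 < c := hφ.deriv2_pos
  obtain ⟨η, hη, h⟩ := hφ.exists_taylor_bound (ε := ε / 4) (by positivity)
  -- The bound `1 / 2` gives `1 + w ≥ 1 / 2`; the bound `ε / (2 * c)` makes the cubic term from the
  -- division by `1 + w` at most `ε / 4 * w ^ 2`.
  refine ⟨min η (min (1 / 2) (ε / (2 * c))), by positivity,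
    (min_le_right _ _).trans (min_le_left _ _), fun w hw => ?_⟩
  have h1 := h w (hw.trans (min_le_left _ _))
  have h2 : |w| ≤ 1 / 2 := hw.trans ((min_le_right _ _).trans (min_le_left _ _))
  have h3 : |w| ≤ ε / (2 * c) := hw.trans ((min_le_right _ _).trans (min_le_right _ _))
  have h4 : 1 / 2 ≤ 1 + w := by
    have := (abs_le.1 h2).1
    linarith
  have hpos : 0 < 1 + w := by linarith
  have e : (φ (1 + w) - deriv φ 1 * w) / (1 + w) - c / 2 * w ^ 2
      = ((φ (1 + w) - deriv φ 1 * w - c / 2 * w ^ 2) - c / 2 * w ^ 2 * w) / (1 + w) := by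
    field_simp
    ring
  rw [e, abs_div, abs_of_pos hpos, div_le_iff₀ hpos]
  have h5 : |c / 2 * w ^ 2 * w| ≤ ε / 4 * w ^ 2 := by
    rw [abs_mul, abs_of_nonneg (by positivity)]
    rw [le_div_iff₀ (by positivity)] at h3
    nlinarith [sq_nonneg w, abs_nonneg w]
  calc _ ≤ ε / 4 * w ^ 2 + ε / 4 * w ^ 2 := (abs_sub _ _).trans (add_le_add h1 h5)
    _ = ε * w ^ 2 * (1 / 2) := by ring
    _ ≤ _ := by gcongr

lemma exists_linear_bound {h : ℝ → ℝ} {c : ℝ} (h0 : h 0 = 0)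
    (hc : HasDerivWithinAt h c (Ici 0) 0) {ε : ℝ} (hε : 0 < ε) :
    ∃ η > 0, ∀ x, 0 ≤ x → x ≤ η → |h x - c * x| ≤ ε * x := by
  have h1 := (hasDerivWithinAt_iff_isLittleO.1 hc).def hε
  obtain ⟨η, hη, hball⟩ := Metric.eventually_nhds_iff.1 (eventually_nhdsWithin_iff.1 h1)
  refine ⟨η / 2, by positivity, fun x hx0 hx => ?_⟩
  have h2 := hball (y := x) (by rw [Real.dist_eq, sub_zero, abs_of_nonneg hx0]; linarith) hx0
  simpa [h0, abs_of_nonneg hx0, mul_comm] using h2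

end Expansion

/-! ### The multiplier of a standardized sample -/

section Standardized

variable {E ι : Type*} [NormedAddCommGroup E] [InnerProductSpace ℝ E] [Fintype ι]

lemma sum_inner_div_one_add_eq_zero {a : ι → E} {τ : E}
    (hsum : ∑ i, (1 / (1 + inner ℝ τ (a i))) • a i = 0) :
    ∑ i, inner ℝ τ (a i) / (1 + inner ℝ τ (a i)) = 0 := by
  have h := congrArg (fun z => inner ℝ τ z) hsum
  simpa [inner_sum, inner_smul_right, div_eq_inv_mul] using h

lemma abs_sum_sq_inner_sub_le {a : ι → E} {τ : E} {δ : ℝ}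
    (hS : ∀ v, ‖∑ i, inner ℝ (a i) v • a i - v‖ ≤ δ * ‖v‖) :
    |∑ i, inner ℝ τ (a i) ^ 2 - ‖τ‖ ^ 2| ≤ δ * ‖τ‖ ^ 2 := by
  have h1 : inner ℝ τ (∑ i, inner ℝ (a i) τ • a i - τ)
      = ∑ i, inner ℝ τ (a i) ^ 2 - ‖τ‖ ^ 2 := by
    rw [inner_sub_right, inner_sum, real_inner_self_eq_norm_sq]
    congr 1
    refine Finset.sum_congr rfl fun i _ => ?_
    rw [inner_smul_right, real_inner_comm τ (a i), sq]
  rw [← h1]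
  calc _ ≤ ‖τ‖ * ‖∑ i, inner ℝ (a i) τ • a i - τ‖ := abs_real_inner_le_norm _ _
    _ ≤ ‖τ‖ * (δ * ‖τ‖) := by gcongr; exact hS τ
    _ = _ := by ring

/-- A priori bound. Pairing the equation with `τ` gives `∑ w_i = ∑ w_i² / (1 + w_i)`, with left side
at most `‖τ‖ * M` and right side at least `(1 - δ) * ‖τ‖² / (1 + ‖τ‖ * δ)`. The smallness of `δ` and
`δ * M` absorbs the term in `‖τ‖`. -/
lemma norm_multiplier_le {a : ι → E} {τ : E} {δ M : ℝ} (hδ0 : 0 ≤ δ) (hδ : δ ≤ 1 / 4)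
    (hM0 : 0 ≤ M) (hδM : δ * M ≤ 1 / 4) (hpos : ∀ i, 0 < 1 + inner ℝ τ (a i))
    (hsum : ∑ i, (1 / (1 + inner ℝ τ (a i))) • a i = 0) (hm : ‖∑ i, a i‖ ≤ M)
    (hS : ∀ v, ‖∑ i, inner ℝ (a i) v • a i - v‖ ≤ δ * ‖v‖) (ha : ∀ i, ‖a i‖ ≤ δ) :
    ‖τ‖ ≤ 2 * M := by
  rcases eq_or_ne τ 0 with rfl | hτ
  · simpa using hM0
  have hτ' : 0 < ‖τ‖ := norm_pos_iff.2 hτ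
  have hQ := (abs_le.1 (abs_sum_sq_inner_sub_le (τ := τ) hS)).1
  have hw : ∀ i, inner ℝ τ (a i) ≤ ‖τ‖ * δ := fun i =>
    (real_inner_le_norm _ _).trans (by gcongr; exact ha i)
  have hD : 0 < 1 + ‖τ‖ * δ := by positivity
  have h1 : (∑ i, inner ℝ τ (a i) ^ 2) / (1 + ‖τ‖ * δ) ≤ inner ℝ τ (∑ i, a i) := by
    have h2 : inner ℝ τ (∑ i, a i) = ∑ i, inner ℝ τ (a i) ^ 2 / (1 + inner ℝ τ (a i)) := by
      rw [inner_sum, ← sub_eq_zero, ← Finset.sum_sub_distrib, ← sum_inner_div_one_add_eq_zero hsum]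
      refine Finset.sum_congr rfl fun i _ => ?_
      have := (hpos i).ne'
      field_simp
      ring
    rw [h2, Finset.sum_div]
    refine Finset.sum_le_sum fun i _ => ?_
    have := hpos i
    gcongr
    exact hw i
  have h3 : inner ℝ τ (∑ i, a i) ≤ ‖τ‖ * M :=
    (real_inner_le_norm _ _).trans (by gcongr)
  have h4 := h1.trans h3
  rw [div_le_iff₀ hD] at h4
  have h5 : (1 - δ) * ‖τ‖ ≤ M * (1 + ‖τ‖ * δ) := by
    refine le_of_mul_le_mul_left ?_ hτ'
    nlinarith
  nlinarith

lemma abs_sum_sq_inner_sub_norm_sq_le {a : ι → E} {τ : E} {δ M : ℝ} (hδ0 : 0 ≤ δ)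
    (hδ : δ ≤ 1 / 4) (hM0 : 0 ≤ M) (hδM : δ * M ≤ 1 / 4)
    (hpos : ∀ i, 0 < 1 + inner ℝ τ (a i))
    (hsum : ∑ i, (1 / (1 + inner ℝ τ (a i))) • a i = 0) (hm : ‖∑ i, a i‖ ≤ M)
    (hS : ∀ v, ‖∑ i, inner ℝ (a i) v • a i - v‖ ≤ δ * ‖v‖) (ha : ∀ i, ‖a i‖ ≤ δ) :
    (∀ i, |inner ℝ τ (a i)| ≤ 2 * M * δ) ∧ ∑ i, inner ℝ τ (a i) ^ 2 ≤ 5 * M ^ 2 ∧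
      |∑ i, inner ℝ τ (a i) ^ 2 - ‖∑ i, a i‖ ^ 2| ≤ δ * (10 * M ^ 2 + 30 * M ^ 3) := by
  have hτ := norm_multiplier_le hδ0 hδ hM0 hδM hpos hsum hm hS ha
  have hτ2 : ‖τ‖ ^ 2 ≤ 4 * M ^ 2 := by nlinarith [norm_nonneg τ]
  have hw : ∀ i, |inner ℝ τ (a i)| ≤ 2 * M * δ := fun i =>
    (abs_real_inner_le_norm _ _).trans (by gcongr; exact ha i)
  have hQ' := abs_sum_sq_inner_sub_le (τ := τ) hS
  set Q := ∑ i, inner ℝ τ (a i) ^ 2 with hQdef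
  set m := ∑ i, a i with hmdef
  have hQ0 : 0 ≤ Q := Finset.sum_nonneg fun i _ => sq_nonneg _
  have hQ : Q ≤ 5 * M ^ 2 := by
    have := (abs_le.1 hQ').2
    nlinarith [sq_nonneg ‖τ‖]
  refine ⟨hw, hQ, ?_⟩
  -- This is `1 / (1 + w) = 1 - w + w² / (1 + w)` inserted in the equation for `τ`.
  have h1 : m - ∑ i, inner ℝ (a i) τ • a i
      = -∑ i, (inner ℝ τ (a i) ^ 2 / (1 + inner ℝ τ (a i))) • a i := by
    rw [← sub_eq_zero, sub_neg_eq_add, hmdef, ← Finset.sum_sub_distrib, ← Finset.sum_add_distrib,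
      ← hsum]
    refine Finset.sum_congr rfl fun i _ => ?_
    have := (hpos i).ne'
    rw [real_inner_comm τ (a i)]
    nth_rw 1 [← one_smul ℝ (a i)]
    rw [← sub_smul, ← add_smul]
    congr 1
    field_simp
    ring
  have h2 : ‖∑ i, (inner ℝ τ (a i) ^ 2 / (1 + inner ℝ τ (a i))) • a i‖ ≤ 10 * M ^ 2 * δ := by
    calc _ ≤ ∑ i, ‖(inner ℝ τ (a i) ^ 2 / (1 + inner ℝ τ (a i))) • a i‖ := norm_sum_le _ _
      _ ≤ ∑ i, (inner ℝ τ (a i) ^ 2 * 2) * δ := by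
        refine Finset.sum_le_sum fun i _ => ?_
        have h3 := hpos i
        have h4 : 1 / 2 ≤ 1 + inner ℝ τ (a i) := by
          have := (abs_le.1 (hw i)).1
          linarith
        rw [norm_smul, Real.norm_of_nonneg (by positivity)]
        gcongr
        · rw [div_le_iff₀ h3]
          nlinarith [sq_nonneg (inner ℝ τ (a i))]
        · exact ha i
      _ = Q * 2 * δ := by rw [← Finset.sum_mul, ← Finset.sum_mul]
      _ ≤ (5 * M ^ 2) * 2 * δ := by gcongr
      _ = _ := by ring
  have h5 : ‖m - τ‖ ≤ 10 * M ^ 2 * δ + δ * (2 * M) := by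
    have e : m - τ = (m - ∑ i, inner ℝ (a i) τ • a i) + (∑ i, inner ℝ (a i) τ • a i - τ) := by
      abel
    rw [e, h1]
    refine (norm_add_le _ _).trans ?_
    rw [norm_neg]
    exact add_le_add h2 ((hS τ).trans (by gcongr))
  have h6 : |‖τ‖ ^ 2 - ‖m‖ ^ 2| ≤ (10 * M ^ 2 * δ + δ * (2 * M)) * (3 * M) := by
    have h7 : |‖τ‖ - ‖m‖| ≤ ‖m - τ‖ := by
      rw [norm_sub_rev]
      exact abs_norm_sub_norm_le τ m
    have e : ‖τ‖ ^ 2 - ‖m‖ ^ 2 = (‖τ‖ - ‖m‖) * (‖τ‖ + ‖m‖) := by ring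
    rw [e, abs_mul, abs_of_nonneg (by positivity : 0 ≤ ‖τ‖ + ‖m‖)]
    gcongr
    · exact h7.trans h5
    · linarith
  calc |Q - ‖m‖ ^ 2| ≤ |Q - ‖τ‖ ^ 2| + |‖τ‖ ^ 2 - ‖m‖ ^ 2| := abs_sub_le _ _ _
    _ ≤ δ * (4 * M ^ 2) + (10 * M ^ 2 * δ + δ * (2 * M)) * (3 * M) := by
      gcongr
      exact hQ'.trans (by gcongr)
    _ = _ := by ring

/-- Deterministic form of the quadratic approximation of the divergence statistic. -/
lemma exists_forall_abs_divergence_sub_norm_sq_le {φ h : ℝ → ℝ} {c : ℝ} (hφ : IsPhi φ)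
    (h0 : h 0 = 0) (hc : HasDerivWithinAt h c (Ici 0) 0) (hc0 : c ≠ 0) {M ε : ℝ} (hM0 : 0 ≤ M)
    (hε : 0 < ε) :
    ∃ δ > 0, ∀ {n : ℕ}, 0 < n → 1 / (n : ℝ) ≤ δ → ∀ {a : Fin n → E} {τ : E},
      (∀ i, 0 < 1 + inner ℝ τ (a i)) →
      ∑ i, (1 / (1 + inner ℝ τ (a i))) • a i = 0 → ‖∑ i, a i‖ ≤ M →
      (∀ v, ‖∑ i, inner ℝ (a i) v • a i - v‖ ≤ δ * ‖v‖) → (∀ i, ‖a i‖ ≤ δ) →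
      ∀ d, n * d = ∑ i, φ (1 + inner ℝ τ (a i)) / (1 + inner ℝ τ (a i)) → 0 ≤ d →
      |2 * (n : ℝ) / (deriv (deriv φ) 1 * c) * h d - ‖∑ i, a i‖ ^ 2| ≤ ε := by
  set k := deriv (deriv φ) 1
  have hk : 0 < k := hφ.deriv2_pos
  set B := 5 * M ^ 2 + 1
  have hB : 0 < B := by positivity
  have hcabs : 0 < |c| := abs_pos.2 hc0
  -- The error `ε` is shared in thirds among the linearization of `h`, the quadratic expansion of
  -- `φ`, and the replacement of `Q = ∑ w_i²` by `‖∑ a_i‖²`. `B` bounds `Q`; the cap `k / 2` gives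
  -- `n * d ≤ k * B`.
  set ε₁ := min (k / 2) (ε / 3 * k / (2 * B))
  have hε₁ : 0 < ε₁ := by positivity
  set ε₂ := ε / 3 * |c| / (2 * B)
  have hε₂ : 0 < ε₂ := by positivity
  obtain ⟨η₁, hη₁, -, hquad⟩ := hφ.exists_quadratic_bound hε₁
  obtain ⟨η₂, hη₂, hlin⟩ := exists_linear_bound h0 hc hε₂
  set C := 10 * M ^ 2 + 30 * M ^ 3 + 1
  have hC : 0 < C := by positivity
  refine ⟨min (min (1 / 4) (1 / (4 * (M + 1)))) (min (η₁ / (2 * (M + 1)))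
    (min (η₂ / (k * B)) (ε / 3 / C))), by positivity, ?_⟩
  intro n hn hnδ a τ hpos hsum hm hS ha d hd hd0
  set δ := min (min (1 / 4) (1 / (4 * (M + 1)))) (min (η₁ / (2 * (M + 1)))
    (min (η₂ / (k * B)) (ε / 3 / C))) with hδdef
  have hδ0 : 0 < δ := by positivity
  have hδ1 : δ ≤ 1 / 4 := (min_le_left _ _).trans (min_le_left _ _)
  have hδ2 : δ ≤ 1 / (4 * (M + 1)) := (min_le_left _ _).trans (min_le_right _ _)
  have hδ3 : δ ≤ η₁ / (2 * (M + 1)) := (min_le_right _ _).trans (min_le_left _ _)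
  have hδ4 : δ ≤ η₂ / (k * B) :=
    (min_le_right _ _).trans ((min_le_right _ _).trans (min_le_left _ _))
  have hδ5 : δ ≤ ε / 3 / C :=
    (min_le_right _ _).trans ((min_le_right _ _).trans (min_le_right _ _))
  rw [le_div_iff₀ (by positivity)] at hδ2 hδ3 hδ4 hδ5
  obtain ⟨hw, hQ, hQm⟩ := abs_sum_sq_inner_sub_norm_sq_le hδ0.le hδ1 hM0 (by nlinarith) hpos hsum
    hm hS ha
  set Q := ∑ i, inner ℝ τ (a i) ^ 2 with hQdef
  have hQ0 : 0 ≤ Q := Finset.sum_nonneg fun i _ => sq_nonneg _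
  have hQB : Q ≤ B := by linarith
  have hnd : |n * d - k / 2 * Q| ≤ ε₁ * Q := by
    -- The linear term may be subtracted because `∑ w_i / (1 + w_i) = 0`.
    have e : n * d = ∑ i, (φ (1 + inner ℝ τ (a i)) - deriv φ 1 * inner ℝ τ (a i))
        / (1 + inner ℝ τ (a i)) := by
      rw [hd, ← sub_zero (∑ i, φ (1 + inner ℝ τ (a i)) / (1 + inner ℝ τ (a i))),
        ← mul_zero (deriv φ 1), ← sum_inner_div_one_add_eq_zero hsum, Finset.mul_sum,
        ← Finset.sum_sub_distrib]
      refine Finset.sum_congr rfl fun i _ => ?_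
      rw [sub_div, mul_div_assoc]
    rw [e, hQdef, Finset.mul_sum, ← Finset.sum_sub_distrib, Finset.mul_sum]
    refine (Finset.abs_sum_le_sum_abs _ _).trans (Finset.sum_le_sum fun i _ => ?_)
    refine hquad _ ((hw i).trans ?_)
    nlinarith
  have hndB : n * d ≤ k * B := by
    have h1 := (abs_le.1 hnd).2
    have h2 : ε₁ ≤ k / 2 := min_le_left _ _
    nlinarith
  have hn' : (0 : ℝ) < n := by exact_mod_cast hn
  -- Since `n * d` is bounded and `1 / n ≤ δ`, `d` falls in the range where `h` is almost linear.
  have hdη : d ≤ η₂ := by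
    rw [div_le_iff₀ hn'] at hnδ
    have h1 : d ≤ δ * n * d := by nlinarith
    have h2 : δ * n * d ≤ δ * (k * B) := by
      rw [mul_assoc]
      gcongr
    linarith
  have hh := hlin d hd0 hdη
  have hkc : 0 < k * |c| := by positivity
  have h1 : |2 * (n : ℝ) / (k * c) * h d - 2 / k * (n * d)| ≤ ε / 3 := by
    have e : 2 * (n : ℝ) / (k * c) * h d - 2 / k * (n * d) = 2 * n / (k * c) * (h d - c * d) := by
      field_simp
    rw [e, abs_mul, abs_div, abs_mul k, abs_of_pos hk, abs_of_pos (by positivity : 0 < 2 * (n : ℝ))]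
    calc _ ≤ 2 * n / (k * |c|) * (ε₂ * d) := by gcongr
      _ = 2 * ε₂ / (k * |c|) * (n * d) := by ring
      _ ≤ 2 * ε₂ / (k * |c|) * (k * B) := by gcongr
      _ = ε / 3 := by
        simp only [ε₂]
        field_simp
  have h2 : |2 / k * (n * d) - Q| ≤ ε / 3 := by
    have e : 2 / k * (n * d) - Q = 2 / k * (n * d - k / 2 * Q) := by
      field_simp
    rw [e, abs_mul, abs_of_pos (by positivity : 0 < 2 / k)]
    calc _ ≤ 2 / k * (ε₁ * Q) := by gcongr
      _ ≤ 2 / k * (ε / 3 * k / (2 * B) * B) := by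
        gcongr
        exact min_le_right _ _
      _ = ε / 3 := by field_simp
  have h3 : |Q - ‖∑ i, a i‖ ^ 2| ≤ ε / 3 := by
    refine hQm.trans (le_trans ?_ hδ5)
    gcongr
    simp only [C]
    linarith
  calc _ ≤ |2 * (n : ℝ) / (k * c) * h d - 2 / k * (n * d)|
        + |2 / k * (n * d) - ‖∑ i, a i‖ ^ 2| := abs_sub_le _ _ _
    _ ≤ |2 * (n : ℝ) / (k * c) * h d - 2 / k * (n * d)| + (|2 / k * (n * d) - Q|
        + |Q - ‖∑ i, a i‖ ^ 2|) := by gcongr; exact abs_sub_le _ _ _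
    _ ≤ ε / 3 + (ε / 3 + ε / 3) := by gcongr
    _ = ε := by ring

end Standardized

/-! ### Limit theorems for standardized random vectors -/

section Limit

lemma continuous_rankOne_self {E : Type*} [NormedAddCommGroup E] [InnerProductSpace ℝ E] :
    Continuous fun z : E => InnerProductSpace.rankOne ℝ z z :=
  (InnerProductSpace.rankOne ℝ).continuous.clm_apply continuous_id

variable {E Ω : Type*} [NormedAddCommGroup E] [InnerProductSpace ℝ E] [FiniteDimensional ℝ E]
  [MeasurableSpace E] [BorelSpace E] {mΩ : MeasurableSpace Ω} {μ : Measure Ω}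
  [IsProbabilityMeasure μ] {Z : ℕ → Ω → E}

/-- The central limit theorem for centred random vectors with identity covariance. -/
theorem tendstoInDistribution_inv_sqrt_smul_sum (hind : iIndepFun Z μ)
    (hid : ∀ i, IdentDistrib (Z i) (Z 0) μ μ) (hmem : MemLp (Z 0) 2 μ) (h0 : ∫ ω, Z 0 ω ∂μ = 0)
    (hcov : ∀ v w, ∫ ω, inner ℝ (Z 0 ω) v * inner ℝ (Z 0 ω) w ∂μ = inner ℝ v w) :
    TendstoInDistribution (fun (n : ℕ) ω => (√n)⁻¹ • ∑ i ∈ Finset.range n, Z i ω) atTop id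
      (fun _ => μ) (stdGaussian E) := by
  have hZ : ∀ i, AEMeasurable (Z i) μ := fun i => (hid i).aemeasurable_fst
  have hV : ∀ n : ℕ, AEMeasurable (fun ω => (√n)⁻¹ • ∑ i ∈ Finset.range n, Z i ω) μ := fun n =>
    (Finset.aemeasurable_fun_sum _ fun i _ => hZ i).const_smul _
  refine ⟨hV, aemeasurable_id, ProbabilityMeasure.tendsto_iff_tendsto_charFun.2 fun t => ?_⟩
  have hint : Integrable (Z 0) μ := hmem.integrable (by norm_num)
  have hX0 : ∫ ω, inner ℝ (Z 0 ω) t ∂μ = 0 := by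
    rw [integral_congr_ae (ae_of_all _ fun ω => real_inner_comm t (Z 0 ω)),
      integral_inner hint, h0, inner_zero_right]
  have hXmem : MemLp (fun ω => inner ℝ (Z 0 ω) t) 2 μ := hmem.inner_const t
  have hvar : Var[fun ω => inner ℝ (Z 0 ω) t; μ] = ‖t‖ ^ 2 := by
    rw [variance_of_integral_eq_zero hXmem.aemeasurable hX0, ← real_inner_self_eq_norm_sq, ← hcov]
    simp [sq]
  have hmeas : Measurable fun z : E => inner ℝ z t := by fun_prop
  -- Cramér–Wold: the characteristic function of the vector at `t` is that of its scalar product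
  -- with `t` at `1`.
  have hclt := tendstoInDistribution_inv_sqrt_mul_sum_sub (P := μ)
    (P' := gaussianReal 0 Var[fun ω => inner ℝ (Z 0 ω) t; μ].toNNReal) (Y := id)
    (X := fun k ω => inner ℝ (Z k ω) t) HasLaw.id hXmem
    (hind.comp (fun _ z => inner ℝ z t) fun _ => hmeas) fun i => (hid i).comp hmeas
  have h1 := ProbabilityMeasure.tendsto_iff_tendsto_charFun.1 hclt.tendsto 1
  have e1 : charFun (Measure.map id (stdGaussian E)) t
      = charFun (Measure.map id (gaussianReal 0 Var[fun ω => inner ℝ (Z 0 ω) t; μ].toNNReal)) 1 := by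
    rw [Measure.map_id, Measure.map_id, charFun_stdGaussian, charFun_gaussianReal, hvar,
      Real.coe_toNNReal _ (by positivity)]
    push_cast
    congr 1
    ring
  have e2 : ∀ n : ℕ, charFun (Measure.map (fun ω => (√n)⁻¹ • ∑ i ∈ Finset.range n, Z i ω) μ) t
      = charFun (Measure.map (fun ω => (√n)⁻¹ * (∑ k ∈ Finset.range n, inner ℝ (Z k ω) t
        - n * ∫ ω, inner ℝ (Z 0 ω) t ∂μ)) μ) 1 := by
    intro n
    rw [charFun_apply, charFun_apply, integral_map (hV n) (by fun_prop),
      integral_map (hclt.forall_aemeasurable n) (by fun_prop)]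
    refine integral_congr_ae (ae_of_all _ fun ω => ?_)
    simp [hX0, real_inner_smul_left, sum_inner]
  simp only [ProbabilityMeasure.coe_mk] at h1 ⊢
  rw [e1]
  exact h1.congr fun n => (e2 n).symm

lemma exists_forall_measure_norm_gt_le {V : ℕ → Ω → E} {ν : Measure E} [IsProbabilityMeasure ν]
    (hV : TendstoInDistribution V atTop id (fun _ => μ) ν) {η : ENNReal} (hη : 0 < η) :
    ∃ M : ℝ, 0 ≤ M ∧ ∀ n, μ {ω | M < ‖V n ω‖} ≤ η := by
  have hprob : ∀ n, IsProbabilityMeasure (μ.map (V n)) := fun n =>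
    Measure.isProbabilityMeasure_map (hV.forall_aemeasurable n)
  have htight : IsTightMeasureSet (range fun n => μ.map (V n)) := by
    refine isTightMeasureSet_of_tendsto_charFun (f := charFun (Measure.map id ν)) ?_
      (ProbabilityMeasure.tendsto_iff_tendsto_charFun.1 hV.tendsto)
    rw [Measure.map_id]
    fun_prop
  have h1 := tendsto_measure_norm_gt_of_isTightMeasureSet htight
  obtain ⟨M, hM0, hM⟩ := ((eventually_ge_atTop 0).and (h1.eventually_le_const hη)).exists
  refine ⟨M, hM0, fun n => ?_⟩
  have h2 := (le_iSup₂_of_le (f := fun κ (_ : κ ∈ range fun n => μ.map (V n)) => κ {x | M < ‖x‖})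
    (μ.map (V n)) (mem_range_self n) le_rfl).trans hM
  rwa [Measure.map_apply_of_aemeasurable (hV.forall_aemeasurable n)
    (measurableSet_lt measurable_const measurable_norm)] at h2

/-- The empirical second moment operator converges to the identity, and the Lyapunov ratio
converges to zero. -/
lemma ae_tendsto_secondMoment_add_lyapunov (hind : iIndepFun Z μ)
    (hid : ∀ i, IdentDistrib (Z i) (Z 0) μ μ) (hmem : MemLp (Z 0) 3 μ)
    (hcov : ∀ v w, ∫ ω, inner ℝ (Z 0 ω) v * inner ℝ (Z 0 ω) w ∂μ = inner ℝ v w) :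
    ∀ᵐ ω ∂μ, Tendsto (fun n : ℕ =>
      ‖(n : ℝ)⁻¹ • ∑ i ∈ Finset.range n, InnerProductSpace.rankOne ℝ (Z i ω) (Z i ω)
        - ContinuousLinearMap.id ℝ E‖
      + (√n)⁻¹ * ((n : ℝ)⁻¹ • ∑ i ∈ Finset.range n, ‖Z i ω‖ ^ 3)) atTop (𝓝 0) := by
  have hmem2 : MemLp (Z 0) 2 μ := hmem.mono_exponent (by norm_num)
  have hcont : Continuous fun z : E => InnerProductSpace.rankOne ℝ z z :=
    continuous_rankOne_self
  have hpair : Pairwise fun i j => IndepFun (Z i) (Z j) μ := fun i j hij => hind.indepFun hij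
  have hint1 : Integrable (fun ω => InnerProductSpace.rankOne ℝ (Z 0 ω) (Z 0 ω)) μ := by
    refine (integrable_norm_iff
      (hcont.comp_aestronglyMeasurable hmem.aestronglyMeasurable)).1 ?_
    simpa [← sq] using hmem2.integrable_norm_pow (by norm_num)
  have hint2 : Integrable (fun ω => ‖Z 0 ω‖ ^ 3) μ := by
    simpa using hmem.integrable_norm_pow (by norm_num)
  have hlln1 := strong_law_ae (μ := μ)
    (fun i ω => InnerProductSpace.rankOne ℝ (Z i ω) (Z i ω)) hint1
    (fun i j hij => (hpair hij).comp hcont.measurable hcont.measurable)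
    fun i => (hid i).comp hcont.measurable
  have hm3 : Measurable fun z : E => ‖z‖ ^ 3 := by fun_prop
  have hlln2 := strong_law_ae (μ := μ) (fun i ω => ‖Z i ω‖ ^ 3) hint2
    (fun i j hij => (hpair hij).comp hm3 hm3) fun i => (hid i).comp hm3
  -- The covariance hypothesis `hcov` in operator form.
  have hmean : ∫ ω, InnerProductSpace.rankOne ℝ (Z 0 ω) (Z 0 ω) ∂μ
      = ContinuousLinearMap.id ℝ E := by
    ext v
    rw [ContinuousLinearMap.integral_apply hint1]
    refine ext_inner_left ℝ fun w => ?_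
    rw [← integral_inner (hint1.apply_continuousLinearMap v), ContinuousLinearMap.id_apply,
      real_inner_comm, ← hcov]
    refine integral_congr_ae (ae_of_all _ fun ω => ?_)
    simp [inner_smul_right, real_inner_comm w]
  filter_upwards [hlln1, hlln2] with ω h1 h2
  rw [hmean] at h1
  have h3 : Tendsto (fun n : ℕ => (√(n : ℝ))⁻¹) atTop (𝓝 0) :=
    tendsto_inv_atTop_zero.comp (Real.tendsto_sqrt_atTop.comp tendsto_natCast_atTop_atTop)
  have h4 := (tendsto_iff_norm_sub_tendsto_zero.1 h1).add (h3.mul h2)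
  simpa using h4

/-- A statistic that is approximated by the squared norm of the normalized sum, as soon as the
latter is bounded, the empirical second moment is close to the identity and every summand is small,
converges in law to the squared norm of a standard normal vector. -/
theorem tendstoInDistribution_of_approx_norm_sq (hind : iIndepFun Z μ)
    (hid : ∀ i, IdentDistrib (Z i) (Z 0) μ μ) (hmem : MemLp (Z 0) 3 μ) (h0 : ∫ ω, Z 0 ω ∂μ = 0)
    (hcov : ∀ v w, ∫ ω, inner ℝ (Z 0 ω) v * inner ℝ (Z 0 ω) w ∂μ = inner ℝ v w)
    {T : ℕ → Ω → ℝ} (hT : ∀ n, AEMeasurable (T n) μ) {S : ℕ → Set Ω}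
    (hS : Tendsto (fun n => μ (S n)ᶜ) atTop (𝓝 0))
    (happrox : ∀ M ε : ℝ, 0 ≤ M → 0 < ε → ∃ δ > 0, ∀ n : ℕ, 0 < n → 1 / (n : ℝ) ≤ δ → ∀ ω ∈ S n,
      ‖∑ i : Fin n, (√n)⁻¹ • Z i ω‖ ≤ M →
      (∀ v, ‖∑ i : Fin n, inner ℝ ((√n)⁻¹ • Z i ω) v • ((√n)⁻¹ • Z i ω) - v‖ ≤ δ * ‖v‖) →
      (∀ i : Fin n, ‖(√n)⁻¹ • Z i ω‖ ≤ δ) →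
      |T n ω - ‖∑ i : Fin n, (√n)⁻¹ • Z i ω‖ ^ 2| ≤ ε) :
    TendstoInDistribution T atTop (fun z => ‖z‖ ^ 2) (fun _ => μ) (stdGaussian E) := by
  have hmem2 : MemLp (Z 0) 2 μ := hmem.mono_exponent (by norm_num)
  have hZ : ∀ i, AEMeasurable (Z i) μ := fun i => (hid i).aemeasurable_fst
  have hclt := tendstoInDistribution_inv_sqrt_smul_sum hind hid hmem2 h0 hcov
  have hsq := hclt.continuous_comp (g := fun z : E => ‖z‖ ^ 2) (by fun_prop)
  refine tendstoInDistribution_of_tendstoInMeasure_sub _ _ hsq ?_ hT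
  rw [tendstoInMeasure_iff_norm]
  intro ε hε
  set R : ℕ → Ω → ℝ := fun n ω =>
    ‖(n : ℝ)⁻¹ • ∑ i ∈ Finset.range n, InnerProductSpace.rankOne ℝ (Z i ω) (Z i ω)
        - ContinuousLinearMap.id ℝ E‖
      + (√n)⁻¹ * ((n : ℝ)⁻¹ • ∑ i ∈ Finset.range n, ‖Z i ω‖ ^ 3) with hR
  have hRmeas : ∀ n, AEStronglyMeasurable (R n) μ := by
    intro n
    have hcont : Continuous fun z : E => InnerProductSpace.rankOne ℝ z z :=
    continuous_rankOne_self
    have h1 : AEStronglyMeasurable (fun ω => ∑ i ∈ Finset.range n,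
        InnerProductSpace.rankOne ℝ (Z i ω) (Z i ω)) μ :=
      Finset.aestronglyMeasurable_fun_sum _ fun i _ =>
        hcont.comp_aestronglyMeasurable (hZ i).aestronglyMeasurable
    have h2 : AEStronglyMeasurable (fun ω => ∑ i ∈ Finset.range n, ‖Z i ω‖ ^ 3) μ :=
      Finset.aestronglyMeasurable_fun_sum _ fun i _ => (hZ i).aestronglyMeasurable.norm.pow 3
    have h3 := ((h1.const_smul ((n : ℝ)⁻¹)).sub
      (aestronglyMeasurable_const (b := ContinuousLinearMap.id ℝ E))).norm
    have h4 := (h2.const_smul ((n : ℝ)⁻¹)).const_mul ((√n)⁻¹)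
    exact h3.add h4
  have hRlim : TendstoInMeasure μ R atTop 0 := tendstoInMeasure_of_tendsto_ae hRmeas
    (ae_tendsto_secondMoment_add_lyapunov hind hid hmem hcov)
  rw [ENNReal.tendsto_nhds_zero]
  intro η hη
  have hη3 : 0 < η / 3 := ENNReal.div_pos hη.ne' (by norm_num)
  -- `M` comes from tightness and is fixed before `δ`, which depends on it.
  obtain ⟨M, hM0, hM⟩ := exists_forall_measure_norm_gt_le hclt hη3
  obtain ⟨δ, hδ, happ⟩ := happrox M (ε / 2) hM0 (by positivity)
  -- `δ` is for the second moment operator. `δ ^ 3` is for the summands: `‖Z_i / √n‖³` is at most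
  -- `n^{-1/2}` times the average of the `‖Z_j‖³`.
  have hδ' : 0 < min δ (δ ^ 3) := by positivity
  have e1 := ENNReal.tendsto_nhds_zero.1 ((tendstoInMeasure_iff_norm.1 hRlim) _ hδ') _ hη3
  have e2 := ENNReal.tendsto_nhds_zero.1 hS _ hη3
  have e3 : ∀ᶠ n : ℕ in atTop, 1 / (n : ℝ) ≤ δ :=
    tendsto_one_div_atTop_nhds_zero_nat.eventually_le_const hδ
  filter_upwards [e1, e2, e3, eventually_gt_atTop 0] with n h1 h2 h3 hn
  have hsub : {ω | ε ≤ ‖(T - fun (n : ℕ) => (fun z : E => ‖z‖ ^ 2) ∘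
        fun ω => (√n)⁻¹ • ∑ i ∈ Finset.range n, Z i ω) n ω - (0 : ℕ → Ω → ℝ) n ω‖}
      ⊆ (S n)ᶜ ∪ ({ω | M < ‖(√n)⁻¹ • ∑ i ∈ Finset.range n, Z i ω‖} ∪
        {ω | min δ (δ ^ 3) ≤ ‖R n ω - (0 : ℕ → Ω → ℝ) n ω‖}) := by
    intro ω hω
    by_contra hcon
    simp only [mem_union, mem_compl_iff, mem_ofPred_eq, not_or, not_not, not_lt, not_le] at hcon
    obtain ⟨hωS, hωM, hωR⟩ := hcon
    have hsum : ∑ i : Fin n, (√n)⁻¹ • Z i ω = (√n)⁻¹ • ∑ i ∈ Finset.range n, Z i ω := by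
      rw [← Finset.smul_sum, Fin.sum_univ_eq_sum_range (fun i => Z i ω)]
    have hn' : (0 : ℝ) < n := by exact_mod_cast hn
    have hinv : (√(n : ℝ))⁻¹ * (√(n : ℝ))⁻¹ = (n : ℝ)⁻¹ := by
      rw [← mul_inv, Real.mul_self_sqrt hn'.le]
    have hA0 : 0 ≤ (√n)⁻¹ * ((n : ℝ)⁻¹ • ∑ i ∈ Finset.range n, ‖Z i ω‖ ^ 3) := by
      rw [smul_eq_mul]
      positivity
    have hR' : R n ω < min δ (δ ^ 3) := by
      refine lt_of_le_of_lt (le_abs_self _) ?_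
      simpa using hωR
    simp only [hR] at hR'
    set Δ := (n : ℝ)⁻¹ • ∑ i ∈ Finset.range n, InnerProductSpace.rankOne ℝ (Z i ω) (Z i ω)
        - ContinuousLinearMap.id ℝ E with hΔ
    have hΔδ : ‖Δ‖ ≤ δ := by
      have := min_le_left δ (δ ^ 3)
      linarith
    have hLδ : (√n)⁻¹ * ((n : ℝ)⁻¹ • ∑ i ∈ Finset.range n, ‖Z i ω‖ ^ 3) ≤ δ ^ 3 := by
      have := min_le_right δ (δ ^ 3)
      have := norm_nonneg Δ
      linarith
    have key := happ n hn h3 ω hωS (by rwa [hsum]) ?_ ?_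
    · rw [hsum] at key
      simp only [mem_ofPred_eq, Pi.sub_apply, Function.comp_apply, Pi.zero_apply, sub_zero,
        Real.norm_eq_abs] at hω
      linarith
    · intro v
      have e : ∑ i : Fin n, inner ℝ ((√n)⁻¹ • Z i ω) v • ((√n)⁻¹ • Z i ω) - v = Δ v := by
        rw [hΔ, _root_.sub_apply, _root_.smul_apply,
          _root_.sum_apply, ContinuousLinearMap.id_apply,
          Fin.sum_univ_eq_sum_range (fun i => inner ℝ ((√n)⁻¹ • Z i ω) v • ((√n)⁻¹ • Z i ω)),
          Finset.smul_sum]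
        congr 1
        refine Finset.sum_congr rfl fun i _ => ?_
        rw [InnerProductSpace.rankOne_apply, real_inner_smul_left, smul_smul, smul_smul, ← hinv]
        congr 1
        ring
      rw [e]
      exact (Δ.le_opNorm v).trans (by gcongr)
    · intro i
      refine le_of_pow_le_pow_left₀ (by norm_num) hδ.le (le_trans ?_ hLδ) (n := 3)
      have hi : ‖Z i ω‖ ^ 3 ≤ ∑ i ∈ Finset.range n, ‖Z i ω‖ ^ 3 :=
        Finset.single_le_sum (f := fun i => ‖Z i ω‖ ^ 3) (fun j _ => by positivity)
          (Finset.mem_range.2 i.2)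
      rw [norm_smul, mul_pow, Real.norm_of_nonneg (by positivity), smul_eq_mul, ← hinv]
      calc _ = (√n)⁻¹ * ((√n)⁻¹ * (√n)⁻¹ * ‖Z i ω‖ ^ 3) := by ring
        _ ≤ _ := by gcongr
  calc _ ≤ μ (S n)ᶜ + (μ {ω | M < ‖(√n)⁻¹ • ∑ i ∈ Finset.range n, Z i ω‖} +
        μ {ω | min δ (δ ^ 3) ≤ ‖R n ω - (0 : ℕ → Ω → ℝ) n ω‖}) :=
      (measure_mono hsub).trans ((measure_union_le _ _).trans (by gcongr; exact measure_union_le _ _))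
    _ ≤ η / 3 + (η / 3 + η / 3) := by gcongr; exacts [hM n, h1]
    _ = η := by rw [← add_assoc, ENNReal.add_thirds]

end Limit

/-! ### Convergence of the statistic -/

section Statistic

variable {q : ℕ}

/-- Factor `M = NᵀN` and take `A = (N⁻¹)ᵀ`, `B = N`, `C = N⁻¹`. A vector with second moment matrix
`M` is sent by `A` to one with identity second moments, and `B` transports the multiplier so that
inner products are kept. -/
lemma exists_whitening {M : Matrix (Fin q) (Fin q) ℝ} (hM : M.PosDef) :
    ∃ A B C : EuclideanSpace ℝ (Fin q) →L[ℝ] EuclideanSpace ℝ (Fin q),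
      (∀ x y, inner ℝ (B x) (A y) = inner ℝ x y) ∧ (∀ x v, inner ℝ (A x) v = inner ℝ x (C v)) ∧
      ∀ v w, (C v).ofLp ⬝ᵥ M.mulVec (C w).ofLp = inner ℝ v w := by
  open scoped MatrixOrder in
  obtain ⟨N, hN⟩ := CStarAlgebra.nonneg_iff_eq_star_mul_self.1
    (Matrix.nonneg_iff_posSemidef.2 hM.posSemidef)
  have hNunit : IsUnit N := by
    rw [Matrix.isUnit_iff_isUnit_det]
    have h1 := (Matrix.isUnit_iff_isUnit_det M).1 hM.isUnit
    rw [hN, Matrix.det_mul] at h1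
    exact isUnit_of_mul_isUnit_right h1
  have hdet := (Matrix.isUnit_iff_isUnit_det N).1 hNunit
  let e := Matrix.toEuclideanCLM (n := Fin q) (𝕜 := ℝ)
  have hmul : ∀ (P Q : Matrix (Fin q) (Fin q) ℝ) x, e P (e Q x) = e (P * Q) x := fun P Q x => by
    rw [map_mul]
    rfl
  have hone : ∀ x, e 1 x = x := fun x => by
    rw [map_one]
    rfl
  have hadj : ∀ (P : Matrix (Fin q) (Fin q) ℝ) x y, inner ℝ (e (star P) x) y = inner ℝ x (e P y) :=
    fun P x y => by
      rw [map_star, ContinuousLinearMap.star_eq_adjoint, ContinuousLinearMap.adjoint_inner_left]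
  refine ⟨e (star N⁻¹), e N, e N⁻¹, fun x y => ?_, fun x v => hadj _ _ _, fun v w => ?_⟩
  · rw [real_inner_comm, hadj, hmul, Matrix.nonsing_inv_mul _ hdet, hone, real_inner_comm]
  · rw [← Matrix.inner_toEuclideanCLM]
    change inner ℝ (e N⁻¹ v) (e M (e N⁻¹ w)) = _
    rw [hN, ← hmul, real_inner_comm, hadj, hmul, hmul, Matrix.mul_nonsing_inv _ hdet, hone, hone,
      real_inner_comm]

lemma stdGaussian_map_norm_sq :
    (stdGaussian (EuclideanSpace ℝ (Fin q))).map (fun z => ‖z‖ ^ 2) = chiSquared q := by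
  rw [← map_pi_eq_stdGaussian, Measure.map_map (by fun_prop) (by fun_prop), chiSquared]
  congr 1
  ext z
  simp [EuclideanSpace.real_norm_sq_eq]

lemma continuous_score (β : EuclideanSpace ℝ (Fin q)) :
    Continuous fun p : EuclideanSpace ℝ (Fin q) × ℝ => score p.1 p.2 β := by
  unfold score
  fun_prop

variable {Ω : Type*} [MeasurableSpace Ω] {μ : Measure Ω}
  {X : ℕ → Ω → EuclideanSpace ℝ (Fin q)} {Y : ℕ → Ω → ℝ} {β₀ : EuclideanSpace ℝ (Fin q)}

lemma IsLogisticSample.measurable_score (hmodel : IsLogisticSample μ X Y β₀) (i : ℕ) :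
    Measurable fun ω => score (X i ω) (Y i ω) β₀ :=
  (continuous_score β₀).measurable.comp ((hmodel.measurable_X i).prodMk (hmodel.measurable_Y i))

lemma IsLogisticSample.measurable_sampleScore (hmodel : IsLogisticSample μ X Y β₀) (n : ℕ) :
    Measurable (sampleScore X Y β₀ n) :=
  measurable_pi_lambda _ fun i => hmodel.measurable_score i

lemma RegularityConditions.memLp_score (hmodel : IsLogisticSample μ X Y β₀)
    (hreg : RegularityConditions μ X Y β₀) : MemLp (fun ω => score (X 0 ω) (Y 0 ω) β₀) 3 μ := by
  obtain ⟨U, hU, G₁, hG₁, hbound⟩ := hreg.bound_deriv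
  have hm := (hmodel.measurable_score 0).aestronglyMeasurable (μ := μ)
  rw [← integrable_norm_rpow_iff hm (by norm_num) (by norm_num)]
  have h3 : (3 : ENNReal).toReal = ((3 : ℕ) : ℝ) := by simp
  simp only [h3, Real.rpow_natCast]
  refine hG₁.mono' (hm.norm.pow 3) ?_
  filter_upwards [hbound] with ω hω
  rw [Real.norm_of_nonneg (by positivity)]
  exact (hω β₀ (mem_of_mem_nhds hU)).2

lemma integral_inner_mul_inner {V : Ω → EuclideanSpace ℝ (Fin q)} (hV : MemLp V 2 μ)
    (p r : EuclideanSpace ℝ (Fin q)) :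
    ∫ ω, inner ℝ (V ω) p * inner ℝ (V ω) r ∂μ
      = p.ofLp ⬝ᵥ (Matrix.of fun j k => ∫ ω, V ω j * V ω k ∂μ).mulVec r.ofLp := by
  have hcoord : ∀ j, MemLp (fun ω => V ω j) 2 μ := fun j =>
    (EuclideanSpace.proj j : EuclideanSpace ℝ (Fin q) →L[ℝ] ℝ).comp_memLp' hV
  have hint : ∀ j k, Integrable (fun ω => V ω j * V ω k) μ := fun j k =>
    (hcoord j).integrable_mul (hcoord k)
  have e : ∀ ω, inner ℝ (V ω) p * inner ℝ (V ω) r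
      = ∑ j, ∑ k, p j * (V ω j * V ω k * r k) := fun ω => by
    simp only [PiLp.inner_apply, RCLike.inner_apply, conj_trivial, Finset.sum_mul_sum]
    exact Finset.sum_congr rfl fun j _ => Finset.sum_congr rfl fun k _ => by ring
  simp only [e]
  rw [integral_finsetSum _ fun j _ => integrable_finsetSum _ fun k _ =>
    ((hint j k).mul_const _).const_mul _]
  simp only [dotProduct, Matrix.mulVec, Matrix.of_apply, Finset.mul_sum]
  refine Finset.sum_congr rfl fun j _ => ?_
  rw [integral_finsetSum _ fun k _ => ((hint j k).mul_const _).const_mul _]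
  refine Finset.sum_congr rfl fun k _ => ?_
  rw [integral_const_mul, integral_mul_const]

lemma mul_phiDivergence_eq {n : ℕ} {G : Fin n → EuclideanSpace ℝ (Fin q)} (φ : ℝ → ℝ)
    (hG : SampleCondition G) :
    n * phiDivergence φ (fun _ : Fin n => 1 / (n : ℝ)) (weights G)
      = ∑ i, φ (1 + inner ℝ (multiplier G) (G i)) / (1 + inner ℝ (multiplier G) (G i)) := by
  have hn := (sampleCondition_iff.1 hG).1
  have hn' : (n : ℝ) ≠ 0 := by positivity
  rw [phiDivergence, Finset.mul_sum]
  refine Finset.sum_congr rfl fun i _ => ?_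
  have hpos := (hG.isMultiplier.one_add_pos hn i).ne'
  have e : 1 / (n : ℝ) / weights G i = 1 + inner ℝ (multiplier G) (G i) := by
    rw [weights]
    field_simp
  rw [e, weights]
  field_simp

/-- `h` enters only through `h 0 = 0`, a nonzero right derivative at `0` of either sign, and
measurability on `[0, ∞)`. This form covers the classical examples, whose `h` need not satisfy
`IsH`. -/
theorem tendstoInDistribution_statistic [IsProbabilityMeasure μ]
    (hmodel : IsLogisticSample μ X Y β₀)
    (hreg : RegularityConditions μ X Y β₀) {φ h : ℝ → ℝ} {c : ℝ} (hφ : IsPhi φ) (h0 : h 0 = 0)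
    (hmeas : Measurable fun x => h (max x 0)) (hderiv : HasDerivWithinAt h c (Ici 0) 0)
    (hc : c ≠ 0) :
    TendstoInDistribution (statistic φ h X Y β₀) atTop id (fun _ => μ) (chiSquared q) := by
  have hc' : derivWithin h (Ici 0) 0 = c := hderiv.derivWithin (uniqueDiffWithinAt_Ici 0)
  obtain ⟨A, B, C, hBA, hAC, hC⟩ := exists_whitening hreg.second_moment_posDef
  let g : ℕ → Ω → EuclideanSpace ℝ (Fin q) := fun i ω => score (X i ω) (Y i ω) β₀
  have hg3 : MemLp (g 0) 3 μ := hreg.memLp_score hmodel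
  have hg2 : MemLp (g 0) 2 μ := hg3.mono_exponent (by norm_num)
  let Z : ℕ → Ω → EuclideanSpace ℝ (Fin q) := fun i ω => A (g i ω)
  have hmF : Measurable fun p : EuclideanSpace ℝ (Fin q) × ℝ => A (score p.1 p.2 β₀) :=
    (A.continuous.comp (continuous_score β₀)).measurable
  have hind : iIndepFun Z μ := hmodel.indep.comp _ fun _ => hmF
  have hid : ∀ i, IdentDistrib (Z i) (Z 0) μ μ := fun i => (hmodel.identDistrib i).comp hmF
  have hmem : MemLp (Z 0) 3 μ := A.comp_memLp' hg3
  have hmean : ∫ ω, Z 0 ω ∂μ = 0 := by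
    have := A.integral_comp_comm hreg.mean_integrable
    rw [hreg.mean_eq_zero, map_zero] at this
    exact this
  have hcov : ∀ v w, ∫ ω, inner ℝ (Z 0 ω) v * inner ℝ (Z 0 ω) w ∂μ = inner ℝ v w := by
    intro v w
    simp only [Z, hAC]
    rw [integral_inner_mul_inner hg2, ← hC v w]
  have hTmeas : ∀ n, Measurable (statistic φ h X Y β₀ n) := fun n =>
    (measurable_statistic_of_sample hφ hmeas _).comp (hmodel.measurable_sampleScore n)
  have hS : Tendsto (fun n => μ {ω | SampleCondition (sampleScore X Y β₀ n ω)}ᶜ) atTop (𝓝 0) := by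
    have h1 : ∀ n, μ {ω | SampleCondition (sampleScore X Y β₀ n ω)}ᶜ
        = 1 - μ {ω | SampleCondition (sampleScore X Y β₀ n ω)} := fun n =>
      prob_compl_eq_one_sub
        (hmodel.measurable_sampleScore n isOpen_sampleCondition.measurableSet)
    simp only [h1]
    simpa using ENNReal.Tendsto.sub tendsto_const_nhds hreg.sample (Or.inl ENNReal.one_ne_top)
  have hlim := tendstoInDistribution_of_approx_norm_sq hind hid hmem hmean hcov
    (fun n => (hTmeas n).aemeasurable) hS ?_
  · refine ⟨hlim.forall_aemeasurable, aemeasurable_id, ?_⟩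
    convert! hlim.tendsto using 3
    exact congrArg 𝓝 (Subtype.ext (Measure.map_id.trans stdGaussian_map_norm_sq.symm))
  intro M ε hM hε
  obtain ⟨δ, hδ, happ⟩ := exists_forall_abs_divergence_sub_norm_sq_le
    (E := EuclideanSpace ℝ (Fin q)) hφ h0 hderiv hc hM hε
  refine ⟨δ, hδ, fun n hn hnδ ω hω hM hS ha => ?_⟩
  have hG : SampleCondition (sampleScore X Y β₀ n ω) := hω
  have hn' : (0 : ℝ) < n := by exact_mod_cast hn
  have hsqrt : √(n : ℝ) ≠ 0 := (Real.sqrt_pos.2 hn').ne'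
  set t := multiplier (sampleScore X Y β₀ n ω)
  -- The factors `√n` and `A`, `B` cancel, so the standardized sample has the same `w_i` as the
  -- original one.
  have hinner : ∀ i : Fin n, inner ℝ (√n • B t) ((√n)⁻¹ • Z i ω)
      = inner ℝ t (sampleScore X Y β₀ n ω i) := by
    intro i
    rw [real_inner_smul_left, real_inner_smul_right, hBA, ← mul_assoc, mul_inv_cancel₀ hsqrt,
      one_mul]
    rfl
  have hsum : ∑ i : Fin n, (1 / (1 + inner ℝ (√n • B t) ((√n)⁻¹ • Z i ω))) • ((√n)⁻¹ • Z i ω)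
      = 0 := by
    have h1 := congrArg (fun z => (√(n : ℝ))⁻¹ • A z) (hG.isMultiplier.sum_eq_zero hn)
    simp only [map_sum, map_smul, map_zero, smul_zero, Finset.smul_sum] at h1
    rw [← h1]
    refine Finset.sum_congr rfl fun i _ => ?_
    rw [hinner, smul_comm]
    rfl
  have key := happ hn hnδ (fun i => by rw [hinner]; exact hG.isMultiplier.one_add_pos hn i) hsum hM
    hS ha (phiDivergence φ (fun _ : Fin n => 1 / (n : ℝ)) (weights (sampleScore X Y β₀ n ω)))
    (by simp only [hinner]; exact mul_phiDivergence_eq φ hG) (hG.phiDivergence_nonneg hφ)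
  rw [statistic, if_pos hG, hc']
  exact key

lemma IsH.measurable {h : ℝ → ℝ} (hh : IsH h) : Measurable fun x => h (max x 0) :=
  (hh.differentiable.continuousOn.comp_continuous (continuous_id.max continuous_const)
    fun x => mem_Ici.2 (le_max_right x 0)).measurable

end Statistic

/-! ### The classical examples -/

section Examples

lemma IsPhi.of_hasDerivAt {φ φ' φ'' : ℝ → ℝ} (h1 : ∀ x, 0 < x → HasDerivAt φ (φ' x) x)
    (h2 : ∀ x, 0 < x → HasDerivAt φ' (φ'' x) x) (hpos : ∀ x, 0 < x → 0 < φ'' x)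
    (hone : φ 1 = 0) : IsPhi φ := by
  have h3 : ∀ x, 0 < x → HasDerivAt (deriv φ) (φ'' x) x := fun x hx =>
    (h2 x hx).congr_of_eventuallyEq
      (by filter_upwards [Ioi_mem_nhds hx] with y hy using (h1 y hy).deriv)
  refine ⟨fun x hx => (h1 x hx).differentiableAt.differentiableWithinAt,
    fun x hx => (h3 x hx).differentiableAt.differentiableWithinAt, ?_, hone, ?_⟩
  · refine convexOn_of_hasDerivWithinAt2_nonneg (f' := φ') (f'' := φ'') (convex_Ioi 0)
      (fun x hx => (h1 x hx).continuousAt.continuousWithinAt) ?_ ?_ ?_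
    · rw [interior_Ioi]
      exact fun x hx => (h1 x hx).hasDerivWithinAt
    · rw [interior_Ioi]
      exact fun x hx => (h2 x hx).hasDerivWithinAt
    · rw [interior_Ioi]
      exact fun x hx => (hpos x hx).le
  · rw [(h3 1 one_pos).deriv]
    exact hpos 1 one_pos

lemma isPhi_powerPhi {a : ℝ} (ha0 : a ≠ 0) (ha1 : a ≠ 1) : IsPhi (powerPhi a) := by
  have ha1' : a - 1 ≠ 0 := sub_ne_zero.2 ha1
  refine IsPhi.of_hasDerivAt (φ' := fun x => (a * x ^ (a - 1) - a) / (a * (a - 1)))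
    (φ'' := fun x => x ^ (a - 1 - 1)) (fun x hx => ?_) (fun x hx => ?_)
    (fun x hx => Real.rpow_pos_of_pos hx _) (by simp [powerPhi])
  · have h := ((((Real.hasDerivAt_rpow_const (p := a) (Or.inl hx.ne')).sub
      (((hasDerivAt_id x).sub_const 1).const_mul a)).sub_const 1).div_const (a * (a - 1)))
    refine h.congr_deriv ?_
    simp
  · have h := (((Real.hasDerivAt_rpow_const (p := a - 1) (Or.inl hx.ne')).const_mul a).sub_const
      a).div_const (a * (a - 1))
    refine h.congr_deriv ?_
    field_simp

lemma isPhi_bhattacharyyaPhi : IsPhi bhattacharyyaPhi := by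
  have e : bhattacharyyaPhi = fun x => -x ^ (1 / 2 : ℝ) + 1 / 2 * (x + 1) := by
    ext x
    rw [bhattacharyyaPhi, Real.sqrt_eq_rpow]
  rw [e]
  refine IsPhi.of_hasDerivAt (φ' := fun x => -(1 / 2 * x ^ (1 / 2 - 1 : ℝ)) + 1 / 2)
    (φ'' := fun x => 1 / 4 * x ^ (1 / 2 - 1 - 1 : ℝ)) (fun x hx => ?_) (fun x hx => ?_)
    (fun x hx => by positivity) (by norm_num)
  · have h := (Real.hasDerivAt_rpow_const (p := 1 / 2) (Or.inl hx.ne')).neg.add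
      (((hasDerivAt_id x).add_const 1).const_mul (1 / 2))
    refine h.congr_deriv ?_
    simp
  · have h := (((Real.hasDerivAt_rpow_const (p := 1 / 2 - 1) (Or.inl hx.ne')).const_mul
      (1 / 2)).neg).add_const (1 / 2)
    refine h.congr_deriv ?_
    ring

lemma hasDerivAt_renyiH {a : ℝ} (ha0 : a ≠ 0) (ha1 : a ≠ 1) : HasDerivAt (renyiH a) 1 0 := by
  have ha1' : a - 1 ≠ 0 := sub_ne_zero.2 ha1
  have h := ((((hasDerivAt_id (0 : ℝ)).const_mul (a * (a - 1))).add_const 1).log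
    (by simp)).const_mul (1 / (a * (a - 1)))
  refine h.congr_deriv ?_
  simp
  field_simp

lemma hasDerivAt_sharmaMittalH {a b : ℝ} (ha1 : a ≠ 1) (hb : b ≠ 1) :
    HasDerivAt (sharmaMittalH a b) a 0 := by
  have ha1' : a - 1 ≠ 0 := sub_ne_zero.2 ha1
  have hb1' : b - 1 ≠ 0 := sub_ne_zero.2 hb
  have h := (((((hasDerivAt_id (0 : ℝ)).const_mul (a * (a - 1))).const_add 1).rpow_const
    (p := (b - 1) / (a - 1)) (by simp)).sub_const 1).const_mul (1 / (b - 1))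
  refine h.congr_deriv ?_
  simp
  field_simp

lemma hasDerivAt_bhattacharyyaH : HasDerivAt bhattacharyyaH 1 0 := by
  have h := ((((hasDerivAt_id (0 : ℝ)).neg).add_const 1).log (by simp)).neg
  refine h.congr_deriv ?_
  simp

end Examples

end EmpLik

end

theorem theorem2 {q : ℕ} {Ω : Type*} [MeasurableSpace Ω] (μ : Measure Ω) [IsProbabilityMeasure μ]
    (X : ℕ → Ω → EuclideanSpace ℝ (Fin q)) (Y : ℕ → Ω → ℝ) (β₀ : EuclideanSpace ℝ (Fin q))
    (hmodel : EmpLik.IsLogisticSample μ X Y β₀)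
    (hreg : EmpLik.RegularityConditions μ X Y β₀) :
    (∀ φ h : ℝ → ℝ, EmpLik.IsPhi φ → EmpLik.IsH h →
      TendstoInDistribution (EmpLik.statistic φ h X Y β₀) atTop id
        (fun _ => μ) (EmpLik.chiSquared q)) ∧
    (∀ a : ℝ, a ≠ 0 → a ≠ 1 →
      TendstoInDistribution (EmpLik.statistic (EmpLik.powerPhi a) (EmpLik.renyiH a) X Y β₀)
        atTop id (fun _ => μ) (EmpLik.chiSquared q)) ∧
    (∀ a b : ℝ, a ≠ 0 → a ≠ 1 → b ≠ 1 →
      TendstoInDistribution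
        (EmpLik.statistic (EmpLik.powerPhi a) (EmpLik.sharmaMittalH a b) X Y β₀)
        atTop id (fun _ => μ) (EmpLik.chiSquared q)) ∧
    TendstoInDistribution
      (EmpLik.statistic EmpLik.bhattacharyyaPhi EmpLik.bhattacharyyaH X Y β₀)
      atTop id (fun _ => μ) (EmpLik.chiSquared q) := by
  refine ⟨fun φ h hφ hh => ?_, fun a ha0 ha1 => ?_, fun a b ha0 ha1 hb => ?_, ?_⟩
  · exact EmpLik.tendstoInDistribution_statistic hmodel hreg hφ hh.map_zero hh.measurable
      (hh.differentiable 0 self_mem_Ici).hasDerivWithinAt hh.deriv_pos.ne'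
  · exact EmpLik.tendstoInDistribution_statistic hmodel hreg (EmpLik.isPhi_powerPhi ha0 ha1)
      -- `Real.log`, and real powers below, are total functions, so `h` is measurable on the whole
      -- line; its values away from `0` do not affect the limit.
      (by simp [EmpLik.renyiH]) (by unfold EmpLik.renyiH; fun_prop)
      (EmpLik.hasDerivAt_renyiH ha0 ha1).hasDerivWithinAt one_ne_zero
  · exact EmpLik.tendstoInDistribution_statistic hmodel hreg (EmpLik.isPhi_powerPhi ha0 ha1)
      (by simp [EmpLik.sharmaMittalH]) (by unfold EmpLik.sharmaMittalH; fun_prop)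
      (EmpLik.hasDerivAt_sharmaMittalH ha1 hb).hasDerivWithinAt ha0
  · exact EmpLik.tendstoInDistribution_statistic hmodel hreg EmpLik.isPhi_bhattacharyyaPhi
      (by simp [EmpLik.bhattacharyyaH]) (by unfold EmpLik.bhattacharyyaH; fun_prop)
      EmpLik.hasDerivAt_bhattacharyyaH.hasDerivWithinAt one_ne_zero
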